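/- Let $X$ be a nondegenerate Peano continuum, i.e. a compact, connected, locally connected metric space with more than one point. A homeomorphism $f:X\to X$ is continuum-wise expansive (cw-expansive) if there is $\alpha>0$ such that $\sup_{n\in\mathbb Z}\operatorname{diam} f^n(C)>\alpha$ for every subcontinuum $C\subseteq X$ with more than one point. Suppose that $X$ admits a cw-expansive homeomorphism. Then every point $x\in X$ has Menger--Urysohn order $2^{\aleph_0}$: the least cardinal $\kappa$ such that $x$ has arbitrarily small open neighborhoods whose boundaries have cardinality at most $\kappa$ is $2^{\aleph_0}$. In particular $X$ is nowhere rim-countable: no point of $X$ has arbitrarily small open neighborhoods with countable boundary. If moreover $X$ is a Peano curve, i.e. has topological dimension one, then: (1) $X$ has only finitely many cyclic elements, and it is their union. Here $r$ separates $x$ and $y$ if $X\setminus\{r\}$ is the union of two disjoint open sets, one containing $x$ and the other containing $y$; the cyclic elements of $X$ are the singletons $\{p\}$ where $p$ is a cut point or an end point (a point of order one) of $X$, and, for each $p$ that is neither, the set of all $x\in X$ such that no point of $X$ separates $p$ and $x$. (2) $X$ has at most countably many local cut points, where $p$ is a local cut point if there is a connected open set $U\ni p$ such that $U\setminus\{p\}$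 is not connected. (3) Every nonempty open subset of $X$ contains a simple closed curve. (4) Every point of $X$ belongs to a continuum of convergence, i.e. to a subcontinuum $K\subseteq X$ with more than one point that is the limit, in the Hausdorff metric, of a sequence of pairwise disjoint subcontinua of $X$, each disjoint from $K$. -/

import Mathlib

open Set Filter Topology
open scoped Cardinal

namespace CWExp

universe u

/-- A subcontinuum: a nonempty compact connected subset. -/
def IsContinuum {X : Type u} [TopologicalSpace X] (C : Set X) : Prop :=
  IsCompact C ∧ IsConnected C

/-- `f` is continuum-wise expansive: for some `α > 0`, every subcontinuum with more than one point
satisfies `sup_{n ∈ ℤ} diam (f ^ n (C)) > α`, that is, some iterate of it, forward or backward,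
has diameter greater than `α`. -/
def IsCWExpansive {X : Type u} [MetricSpace X] (f : X ≃ₜ X) : Prop :=
  ∃ α : ℝ, 0 < α ∧ ∀ C : Set X, IsContinuum C → C.Nontrivial →
    ∃ n : ℤ, α < Metric.diam (⇑(f ^ n) '' C)

/-- `x` has arbitrarily small open neighbourhoods whose boundary has cardinality at most `κ`. -/
def OrderLE {X : Type u} [TopologicalSpace X] (x : X) (κ : Cardinal.{u}) : Prop :=
  ∀ V ∈ 𝓝 x, ∃ U : Set X, IsOpen U ∧ x ∈ U ∧ U ⊆ V ∧ #(frontier U) ≤ κ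

/-- The Menger–Urysohn order of `X` at `x`, as a cardinal. -/
noncomputable def order {X : Type u} [TopologicalSpace X] (x : X) : Cardinal.{u} :=
  sInf {κ : Cardinal.{u} | OrderLE x κ}

/-- `x` has arbitrarily small open neighbourhoods with countable boundary. -/
def IsRimCountableAt {X : Type u} [TopologicalSpace X] (x : X) : Prop :=
  ∀ V ∈ 𝓝 x, ∃ U : Set X, IsOpen U ∧ x ∈ U ∧ U ⊆ V ∧ (frontier U).Countable

/-- No point has arbitrarily small open neighbourhoods with countable boundary. -/
def NowhereRimCountable (X : Type u) [TopologicalSpace X] : Prop :=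
  ∀ x : X, ¬ IsRimCountableAt x

/-- `X` has topological dimension one (a continuum with this property is a curve). -/
def IsOneDimensional (X : Type u) [TopologicalSpace X] : Prop :=
  smallInductiveDimension X = 1

/-- A cut point of the (connected) space `X`. -/
def IsCutPoint {X : Type u} [TopologicalSpace X] (p : X) : Prop :=
  ¬ IsPreconnected ({p}ᶜ : Set X)

/-- An end point: a point of order one. -/
def IsEndPoint {X : Type u} [TopologicalSpace X] (p : X) : Prop :=
  order p = 1

/-- The point `r` separates the points `x` and `y` in `X`. -/
def Separates {X : Type u} [TopologicalSpace X] (r x y : X) : Prop :=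
  ∃ A B : Set X, IsOpen A ∧ IsOpen B ∧ Disjoint A B ∧ A ∪ B = {r}ᶜ ∧ x ∈ A ∧ y ∈ B

/-- Conjugate points: no point of `X` separates them. -/
def IsConjugate {X : Type u} [TopologicalSpace X] (x y : X) : Prop :=
  ∀ r : X, ¬ Separates r x y

/-- Cyclic elements in the sense of Whyburn: the singletons of the cut points and of the end
points, and, for every point `p` that is neither, the set of all points conjugate to `p`. -/
def IsCyclicElement {X : Type u} [TopologicalSpace X] (E : Set X) : Prop :=
  ∃ p : X, ((IsCutPoint p ∨ IsEndPoint p) ∧ E = {p}) ∨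
    (¬ IsCutPoint p ∧ ¬ IsEndPoint p ∧ E = {x | IsConjugate p x})

/-- A local cut point: a cut point of some connected open neighbourhood. -/
def IsLocalCutPoint {X : Type u} [TopologicalSpace X] (p : X) : Prop :=
  ∃ U : Set X, IsOpen U ∧ IsConnected U ∧ p ∈ U ∧ ¬ IsPreconnected (U \ {p})

/-- A simple closed curve: a subset homeomorphic to the circle. -/
def IsSimpleClosedCurve {X : Type u} [TopologicalSpace X] (C : Set X) : Prop :=
  Nonempty (C ≃ₜ Circle)

/-- A continuum of convergence: a nondegenerate subcontinuum `K` that is the limit, in the Hausdorff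
metric, of pairwise disjoint subcontinua which are disjoint from `K`. -/
def IsContinuumOfConvergence {X : Type u} [MetricSpace X] (K : Set X) : Prop :=
  IsContinuum K ∧ K.Nontrivial ∧ ∃ C : ℕ → Set X,
    (∀ n, IsContinuum (C n)) ∧ (∀ n, Disjoint (C n) K) ∧
    (∀ m n, m ≠ n → Disjoint (C m) (C n)) ∧
    Tendsto (fun n => Metric.hausdorffDist (C n) K) atTop (𝓝 0)

end CWExp

/-!
Cw-expansive homeomorphisms of Peano continua.

**Dynamics.** Let `α` be a constant of cw-expansivity of `f`. Compactness of the hyperspace of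
subcontinua, together with boundary bumping, gives the basic fact that a continuum which is small at
two times is small at all times in between (`IsCWConstant.exists_smallAt_between`). It follows that
there are no Lyapunov stable points (`IsCWConstant.exists_not_smallAt_of_isOpen`), and from this,
applied to `f⁻¹`, that every point lies on a continuum of definite size all of whose forward
iterates are small (`IsCWConstant.exists_stable_continuum`).

**Order.** Let `U` be a neighbourhood smaller than the stable continua. Each of these that starts in
`U` meets the boundary of `U`, so `U` is covered by the stable sets of the boundary points. Stable
sets are closed and have empty interior, so by Baire's theorem the boundary is uncountable, and a
closed uncountable set has the cardinality of the continuum. In the same way one finds stable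
continua, through points converging to a given point, that are disjoint from each other and from
their limit: the given point lies in a continuum of convergence.

**Separation.** The rest uses only that `X` is nowhere rim-countable and, for the cyclic elements,
that continua with small iterates in the far past and the far future are small throughout.

* The points that separate `a` and `b` in a connected open set are linearly ordered. All but
  countably many of them are limits of separators from both sides and leave only two components, and
  such a point has small neighbourhoods with finite boundary. So there are only countably many
  separators (`countable_separators`), and hence only countably many local cut points.
* A point that is conjugate to no other also has small neighbourhoods with finite boundary
  (`isRimCountableAt_of_forall_exists_isOpen` covers both cases). So every point lies in a
  nondegenerate maximal set of pairwise conjugate points. These sets are continua, they form a null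
  family, and `f` permutes them. An infinite orbit would consist of sets that are small
  in the far past and the far future, hence always, against expansivity; and each orbit has one of
  the finitely many large members. So there are finitely many such sets. They cover `X`, any two of
  them have at most one common point, and every cut point lies in two of them, so there are finitely
  many cut points too.
* An arc in an open set contains a point that is not a local cut point, so its end points are joined
  by a second arc avoiding this point, and two such arcs contain a simple closed curve. The arcs
  come from the local path connectedness of Peano continua
  (`locallyPathConnectedSpace_of_compact`) and from loop erasure (`exists_injOn_path`).
-/

namespace CWExp

/-! ### Continua and Hausdorff limits -/

section Continua

variable {X : Type*}

/-- Boundary bumping: in a continuum `C`, the part of the sublevel set `{g ≤ r}` that is connected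
to `x` reaches the level `r` as soon as `g` takes a value at least `r` somewhere on `C`. -/
lemma IsContinuum.exists_subcontinuum_level [TopologicalSpace X] [T2Space X] {C : Set X}
    (hC : IsContinuum C) {g : X → ℝ} (hg : Continuous g) {x y : X} {r : ℝ} (hx : x ∈ C)
    (hxr : g x ≤ r) (hy : y ∈ C) (hyr : r ≤ g y) :
    ∃ A ⊆ C, IsContinuum A ∧ x ∈ A ∧ (∀ z ∈ A, g z ≤ r) ∧ ∃ z ∈ A, g z = r := by
  set K : Set X := C ∩ {z | g z ≤ r} with hK
  have hKc : IsCompact K := hC.1.inter_right (isClosed_le hg continuous_const)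
  have : CompactSpace K := isCompact_iff_compactSpace.1 hKc
  let x' : K := ⟨x, hx, hxr⟩
  refine ⟨Subtype.val '' connectedComponent x', ?_, ⟨?_, ?_⟩, ?_, ?_, ?_⟩
  · rintro _ ⟨z, -, rfl⟩
    exact z.2.1
  · exact isClosed_connectedComponent.isCompact.image continuous_subtype_val
  · exact isConnected_connectedComponent.image _ continuous_subtype_val.continuousOn
  · exact ⟨x', mem_connectedComponent, rfl⟩
  · rintro _ ⟨z, -, rfl⟩
    exact z.2.2
  by_contra hcon
  push Not at hcon
  -- The component of `x` in `K` is an intersection of clopen sets, so one of them misses `{g = r}`.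
  let B : Set K := {z | g z = r}
  have hB : IsCompact B :=
    (isClosed_eq (hg.comp continuous_subtype_val) continuous_const).isCompact
  have hemp : B ∩ ⋂ s : {s : Set K // IsClopen s ∧ x' ∈ s}, (s : Set K) = ∅ := by
    rw [← connectedComponent_eq_iInter_isClopen]
    ext z
    simp only [mem_inter_iff, mem_empty_iff_false, iff_false, not_and]
    intro hzB hz
    exact hcon z ⟨z, hz, rfl⟩ hzB
  obtain ⟨t, ht⟩ := hB.elim_finite_subfamily_closed _ (fun s => s.2.1.1) hemp
  set P : Set K := ⋂ s ∈ t, (s : Set K) with hP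
  have hPcl : IsClopen P := isClopen_biInter_finset fun s _ => s.2.1
  have hxP : x' ∈ P := by
    simp only [hP, mem_iInter]
    exact fun s _ => s.2.2
  have hlt : ∀ z ∈ P, g z < r := by
    intro z hz
    refine lt_of_le_of_ne z.2.2 fun h => ?_
    have : z ∈ B ∩ P := ⟨h, hz⟩
    rw [ht] at this
    exact this
  obtain ⟨O, hO, hOP⟩ := isOpen_induced_iff.1 hPcl.2
  have hP' : IsClosed (Subtype.val '' P : Set X) :=
    (hPcl.1.isCompact.image continuous_subtype_val).isClosed
  have hmem : ∀ z ∈ C, z ∈ O ∩ {z | g z < r} → z ∈ (Subtype.val '' P : Set X) := by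
    intro z hz hzO
    refine ⟨⟨z, hz, show g z ≤ r from le_of_lt hzO.2⟩, ?_, rfl⟩
    rw [← hOP]
    exact hzO.1
  rcases isPreconnected_iff_subset_of_disjoint.1 hC.2.isPreconnected (O ∩ {z | g z < r})
    (Subtype.val '' P)ᶜ (hO.inter (isOpen_lt hg continuous_const)) hP'.isOpen_compl
    (fun z hz => by
      by_cases h : z ∈ (Subtype.val '' P : Set X)
      · left
        obtain ⟨w, hw, rfl⟩ := h
        refine ⟨?_, hlt w hw⟩
        rw [← hOP] at hw
        exact hw
      · exact Or.inr h)
    (by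
      ext z
      simp only [mem_inter_iff, mem_empty_iff_false, iff_false]
      rintro ⟨hz, hzO, hzP⟩
      exact hzP (hmem z hz hzO)) with h | h
  · exact absurd (h hy).2 (not_lt.2 hyr)
  · exact h hx ⟨x', hxP, rfl⟩

lemma IsContinuum.image {Y : Type*} [TopologicalSpace X] [TopologicalSpace Y] {C : Set X}
    (hC : IsContinuum C) {g : X → Y} (hg : Continuous g) : IsContinuum (g '' C) :=
  ⟨hC.1.image hg, hC.2.image _ hg.continuousOn⟩

/-- `C n` converges to `K` in the sense of the Hausdorff metric, expressed through points. -/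
def HausdorffLim [PseudoMetricSpace X] (C : ℕ → Set X) (K : Set X) : Prop :=
  ∀ η > 0, ∀ᶠ n in atTop, (∀ w ∈ C n, ∃ z ∈ K, dist w z < η) ∧ ∀ z ∈ K, ∃ w ∈ C n, dist z w < η

lemma HausdorffLim.tendsto [PseudoMetricSpace X] {C : ℕ → Set X} {K : Set X}
    (h : HausdorffLim C K) : Tendsto (fun n => Metric.hausdorffDist (C n) K) atTop (𝓝 0) := by
  rw [Metric.tendsto_atTop]
  intro η hη
  obtain ⟨N, hN⟩ := eventually_atTop.1 (h (η / 2) (half_pos hη))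
  refine ⟨N, fun n hn => ?_⟩
  rw [Real.dist_0_eq_abs, abs_of_nonneg Metric.hausdorffDist_nonneg]
  refine lt_of_le_of_lt (Metric.hausdorffDist_le_of_mem_dist (half_pos hη).le ?_ ?_)
    (half_lt_self hη)
  · intro w hw
    obtain ⟨z, hz, hd⟩ := (hN n hn).1 w hw
    exact ⟨z, hz, hd.le⟩
  · intro z hz
    obtain ⟨w, hw, hd⟩ := (hN n hn).2 z hz
    exact ⟨w, hw, hd.le⟩

lemma HausdorffLim.mem_of_tendsto [PseudoMetricSpace X] {C : ℕ → Set X} {K : Set X}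
    (h : HausdorffLim C K) (hK : IsClosed K) {w : ℕ → X} {z : X} (hw : ∀ᶠ n in atTop, w n ∈ C n)
    (hz : Tendsto w atTop (𝓝 z)) : z ∈ K := by
  rw [← hK.closure_eq, Metric.mem_closure_iff]
  intro η hη
  obtain ⟨n, hn, hwn, hd⟩ := ((h (η / 2) (half_pos hη)).and
    (hw.and (Metric.tendsto_nhds.1 hz (η / 2) (half_pos hη)))).exists
  obtain ⟨k, hk, hwk⟩ := hn.1 _ hwn
  refine ⟨k, hk, ?_⟩
  have := dist_triangle z (w n) k
  rw [dist_comm z (w n)] at this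
  linarith

lemma HausdorffLim.exists_tendsto [PseudoMetricSpace X] {C : ℕ → Set X} {K : Set X}
    (h : HausdorffLim C K) (hne : ∀ n, (C n).Nonempty) {z : X} (hz : z ∈ K) :
    ∃ w : ℕ → X, (∀ n, w n ∈ C n) ∧ Tendsto w atTop (𝓝 z) := by
  have : ∀ n : ℕ, ∃ w ∈ C n, dist z w < Metric.infDist z (C n) + 1 / (n + 1) := fun n =>
    (Metric.infDist_lt_iff (hne n)).1 (lt_add_of_pos_right _ Nat.one_div_pos_of_nat)
  choose w hw hd using this
  refine ⟨w, hw, Metric.tendsto_nhds.2 fun η hη => ?_⟩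
  have h1 := (tendsto_one_div_add_atTop_nhds_zero_nat (𝕜 := ℝ)).eventually_lt_const (half_pos hη)
  filter_upwards [h1, h (η / 2) (half_pos hη)] with n hn hn'
  obtain ⟨v, hv, hdv⟩ := hn'.2 z hz
  have := Metric.infDist_le_dist_of_mem (x := z) hv
  rw [dist_comm]
  linarith [hd n]

/-- A closed relation that holds between any two points of `C n`, for large `n`, passes to the
Hausdorff limit. -/
lemma HausdorffLim.forall_mem_of_isClosed [PseudoMetricSpace X] {C : ℕ → Set X} {K : Set X}
    (h : HausdorffLim C K) (hne : ∀ n, (C n).Nonempty) {R : Set (X × X)} (hR : IsClosed R)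
    (hCR : ∀ᶠ n in atTop, ∀ x ∈ C n, ∀ y ∈ C n, (x, y) ∈ R) : ∀ x ∈ K, ∀ y ∈ K, (x, y) ∈ R := by
  intro x hx y hy
  obtain ⟨w, hw, hwt⟩ := h.exists_tendsto hne hx
  obtain ⟨v, hv, hvt⟩ := h.exists_tendsto hne hy
  exact hR.mem_of_tendsto (hwt.prodMk_nhds hvt)
    (hCR.mono fun n hn => hn _ (hw n) _ (hv n))

/-- If the `C n` contain pairs of points at distance at least `δ`, the limit contains a pair of
points at distance at least `δ / 2`. -/
lemma HausdorffLim.exists_far [PseudoMetricSpace X] {C : ℕ → Set X} {K : Set X}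
    (h : HausdorffLim C K) {δ : ℝ} (hδ : 0 < δ)
    (hC : ∀ n, ∃ x ∈ C n, ∃ y ∈ C n, δ ≤ dist x y) : ∃ x ∈ K, ∃ y ∈ K, δ / 2 ≤ dist x y := by
  obtain ⟨n, hn⟩ := (h (δ / 4) (by positivity)).exists
  obtain ⟨x, hx, y, hy, hd⟩ := hC n
  obtain ⟨x', hx', hdx⟩ := hn.1 x hx
  obtain ⟨y', hy', hdy⟩ := hn.1 y hy
  refine ⟨x', hx', y', hy', ?_⟩
  have h1 := dist_triangle x x' y
  have h2 := dist_triangle x' y' y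
  rw [dist_comm y' y] at h2
  linarith

/-- A Hausdorff limit of connected sets is connected. -/
lemma HausdorffLim.isPreconnected [PseudoMetricSpace X] {C : ℕ → Set X} {K : Set X}
    (h : HausdorffLim C K) (hC : ∀ n, IsConnected (C n)) (hK : IsCompact K) (hKc : IsClosed K) :
    IsPreconnected K := by
  rw [isPreconnected_iff_subset_of_fully_disjoint_closed hKc]
  intro u v hu hv huv hd
  obtain ⟨δ, hδ, hdis⟩ := (hd.mono (inter_subset_right (s := K))
    (inter_subset_right (s := K))).exists_thickenings (hK.inter_right hu) (hKc.inter hv)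
  obtain ⟨n, hn⟩ := (h δ hδ).exists
  have hsub : C n ⊆ Metric.thickening δ (K ∩ u) ∪ Metric.thickening δ (K ∩ v) := by
    intro w hw
    obtain ⟨z, hz, hdz⟩ := hn.1 w hw
    rcases huv hz with hz' | hz'
    · exact Or.inl (Metric.mem_thickening_iff.2 ⟨z, ⟨hz, hz'⟩, hdz⟩)
    · exact Or.inr (Metric.mem_thickening_iff.2 ⟨z, ⟨hz, hz'⟩, hdz⟩)
  rcases (hC n).isPreconnected.subset_or_subset Metric.isOpen_thickening Metric.isOpen_thickening
    hdis hsub with hs | hs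
  · left
    intro z hz
    refine (huv hz).resolve_right fun hzv => ?_
    obtain ⟨w, hw, hdw⟩ := hn.2 z hz
    exact disjoint_left.1 hdis (hs hw)
      (Metric.mem_thickening_iff.2 ⟨z, ⟨hz, hzv⟩, by rwa [dist_comm]⟩)
  · right
    intro z hz
    refine (huv hz).resolve_left fun hzu => ?_
    obtain ⟨w, hw, hdw⟩ := hn.2 z hz
    exact disjoint_right.1 hdis (hs hw)
      (Metric.mem_thickening_iff.2 ⟨z, ⟨hz, hzu⟩, by rwa [dist_comm]⟩)

/-- Compactness of the hyperspace of subcontinua. -/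
lemma exists_subseq_hausdorffLim [MetricSpace X] [CompactSpace X] (C : ℕ → Set X)
    (hC : ∀ n, IsContinuum (C n)) :
    ∃ (K : Set X) (φ : ℕ → ℕ), StrictMono φ ∧ IsContinuum K ∧
      HausdorffLim (fun n => C (φ n)) K := by
  let D : ℕ → TopologicalSpace.NonemptyCompacts X := fun n => ⟨⟨C n, (hC n).1⟩, (hC n).2.1⟩
  obtain ⟨K, φ, hφ, hlim⟩ := CompactSpace.tendsto_subseq D
  have hL : HausdorffLim (fun n => C (φ n)) (K : Set X) := by
    intro η hη
    filter_upwards [Metric.tendsto_nhds.1 hlim η hη] with n hn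
    rw [Metric.NonemptyCompacts.dist_eq] at hn
    have hfin : Metric.hausdorffEDist (C (φ n)) (K : Set X) ≠ ⊤ :=
      Metric.hausdorffEDist_ne_top_of_nonempty_of_bounded (hC _).2.1 K.nonempty
        (hC _).1.isBounded K.isCompact.isBounded
    refine ⟨fun w hw => Metric.exists_dist_lt_of_hausdorffDist_lt hw hn hfin, fun z hz => ?_⟩
    obtain ⟨w, hw, hd⟩ := Metric.exists_dist_lt_of_hausdorffDist_lt' hz hn hfin
    exact ⟨w, hw, by rwa [dist_comm]⟩
  exact ⟨K, φ, hφ, ⟨K.isCompact, K.nonempty,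
    hL.isPreconnected (fun n => (hC _).2) K.isCompact K.isCompact.isClosed⟩, hL⟩

/-- A compact locally connected metric space is uniformly locally connected. -/
lemma exists_uniform_small_continuum [MetricSpace X] [CompactSpace X] [LocallyConnectedSpace X]
    {ε : ℝ} (hε : 0 < ε) : ∃ δ > 0, ∀ x y : X, dist x y < δ →
      ∃ T : Set X, IsContinuum T ∧ x ∈ T ∧ y ∈ T ∧ ∀ a ∈ T, ∀ b ∈ T, dist a b ≤ ε := by
  have hW : ∀ x : X, IsOpen (connectedComponentIn (Metric.ball x (ε / 2)) x) := fun x =>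
    Metric.isOpen_ball.connectedComponentIn
  have hmem : ∀ x : X, x ∈ connectedComponentIn (Metric.ball x (ε / 2)) x := fun x =>
    mem_connectedComponentIn (Metric.mem_ball_self (half_pos hε))
  obtain ⟨δ, hδ, h⟩ := lebesgue_number_lemma_of_metric isCompact_univ hW
    (fun x _ => mem_iUnion.2 ⟨x, hmem x⟩)
  refine ⟨δ, hδ, fun x y hxy => ?_⟩
  obtain ⟨c, hc⟩ := h x (mem_univ x)
  refine ⟨closure (connectedComponentIn (Metric.ball c (ε / 2)) c), ⟨isClosed_closure.isCompact,
    ⟨c, subset_closure (hmem c)⟩, isPreconnected_connectedComponentIn.closure⟩,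
    subset_closure (hc (Metric.mem_ball_self hδ)),
    subset_closure (hc (by rwa [Metric.mem_ball, dist_comm])), fun a ha b hb => ?_⟩
  have hsub : closure (connectedComponentIn (Metric.ball c (ε / 2)) c)
      ⊆ Metric.closedBall c (ε / 2) :=
    closure_minimal ((connectedComponentIn_subset _ _).trans Metric.ball_subset_closedBall)
      Metric.isClosed_closedBall
  have h1 := Metric.mem_closedBall.1 (hsub ha)
  have h2 := Metric.mem_closedBall'.1 (hsub hb)
  linarith [dist_triangle a c b]

end Continua

/-! ### Stable continua of cw-expansive homeomorphisms -/

section Dynamics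

variable {X : Type*}

/-- `C` has diameter at most `c` at time `n`: any two of its points have `n`-th iterates at distance
at most `c`. -/
def SmallAt [MetricSpace X] (f : X ≃ₜ X) (C : Set X) (c : ℝ) (n : ℤ) : Prop :=
  ∀ x ∈ C, ∀ y ∈ C, dist ((f ^ n) x) ((f ^ n) y) ≤ c

/-- `α` is a constant of cw-expansivity of `f`: no nondegenerate continuum has all its iterates of
diameter at most `α`. -/
def IsCWConstant [MetricSpace X] (f : X ≃ₜ X) (α : ℝ) : Prop :=
  0 < α ∧ ∀ C : Set X, IsContinuum C → C.Nontrivial → ∃ n : ℤ, ¬ SmallAt f C α n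

lemma zpow_apply_zpow_apply [TopologicalSpace X] (f : X ≃ₜ X) (m n : ℤ) (x : X) :
    (f ^ m) ((f ^ n) x) = (f ^ (m + n)) x := by
  rw [zpow_add]; rfl

lemma zpow_neg_apply_zpow_apply [TopologicalSpace X] (f : X ≃ₜ X) (n : ℤ) (x : X) :
    (f ^ (-n)) ((f ^ n) x) = x := by
  rw [zpow_apply_zpow_apply, neg_add_cancel, zpow_zero]; rfl

lemma zpow_apply_zpow_neg_apply [TopologicalSpace X] (f : X ≃ₜ X) (n : ℤ) (x : X) :
    (f ^ n) ((f ^ (-n)) x) = x := by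
  rw [zpow_apply_zpow_apply, add_neg_cancel, zpow_zero]; rfl

lemma zpow_image_zpow_image [TopologicalSpace X] (f : X ≃ₜ X) (m n : ℤ) (E : Set X) :
    (f ^ m) '' ((f ^ n) '' E) = (f ^ (m + n)) '' E := by
  rw [zpow_add, image_image]
  rfl

lemma inv_zpow_apply [TopologicalSpace X] (f : X ≃ₜ X) (n : ℤ) (x : X) :
    (f⁻¹ ^ n) x = (f ^ (-n)) x := by
  rw [inv_zpow']

variable [MetricSpace X] {f : X ≃ₜ X} {α : ℝ} {C : Set X} {c : ℝ} {n m : ℤ}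

lemma SmallAt.mono {D : Set X} {d : ℝ} (h : SmallAt f C c n) (hD : D ⊆ C) (hd : c ≤ d) :
    SmallAt f D d n := fun x hx y hy => (h x (hD hx) y (hD hy)).trans hd

lemma smallAt_image_iff : SmallAt f ((f ^ m) '' C) c n ↔ SmallAt f C c (n + m) := by
  constructor
  · intro h x hx y hy
    have := h _ (mem_image_of_mem _ hx) _ (mem_image_of_mem _ hy)
    rwa [zpow_apply_zpow_apply, zpow_apply_zpow_apply] at this
  · rintro h _ ⟨x, hx, rfl⟩ _ ⟨y, hy, rfl⟩
    rw [zpow_apply_zpow_apply, zpow_apply_zpow_apply]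
    exact h x hx y hy

lemma smallAt_inv_iff : SmallAt f⁻¹ C c n ↔ SmallAt f C c (-n) := by
  simp only [SmallAt, inv_zpow_apply]

lemma smallAt_zero_iff : SmallAt f C c 0 ↔ ∀ x ∈ C, ∀ y ∈ C, dist x y ≤ c := by
  simp only [SmallAt, zpow_zero]; rfl

lemma isClosed_smallAt_rel (f : X ≃ₜ X) (c : ℝ) (n : ℤ) :
    IsClosed {p : X × X | dist ((f ^ n) p.1) ((f ^ n) p.2) ≤ c} :=
  isClosed_le (((f ^ n).continuous.comp continuous_fst).dist
    ((f ^ n).continuous.comp continuous_snd)) continuous_const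

lemma HausdorffLim.smallAt {C : ℕ → Set X} {K : Set X} (h : HausdorffLim C K)
    (hne : ∀ n, (C n).Nonempty) (hC : ∀ᶠ k in atTop, SmallAt f (C k) c n) : SmallAt f K c n :=
  h.forall_mem_of_isClosed hne (isClosed_smallAt_rel f c n) hC

lemma IsCWExpansive.exists_isCWConstant (hf : IsCWExpansive f) : ∃ α, IsCWConstant f α := by
  obtain ⟨α, hα, h⟩ := hf
  refine ⟨α, hα, fun C hC hn => ?_⟩
  obtain ⟨n, hlt⟩ := h C hC hn
  refine ⟨n, fun hs => not_le.2 hlt (Metric.diam_le_of_forall_dist_le hα.le ?_)⟩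
  rintro _ ⟨x, hx, rfl⟩ _ ⟨y, hy, rfl⟩
  exact hs x hx y hy

lemma IsCWConstant.inv (h : IsCWConstant f α) : IsCWConstant f⁻¹ α := by
  refine ⟨h.1, fun C hC hn => ?_⟩
  obtain ⟨n, hlt⟩ := h.2 C hC hn
  exact ⟨-n, by rwa [smallAt_inv_iff, neg_neg]⟩

/-- Boundary bumping for the metrics `max_{a ≤ i ≤ b} dist (f ^ i ·) (f ^ i ·)`. -/
lemma exists_subcontinuum_orbit_level (f : X ≃ₜ X) (hC : IsContinuum C) {x y : X} (hx : x ∈ C)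
    (hy : y ∈ C) {a b j : ℤ} (haj : a ≤ j) (hjb : j ≤ b) {r : ℝ} (hr : 0 ≤ r)
    (hxy : r ≤ dist ((f ^ j) x) ((f ^ j) y)) :
    ∃ A ⊆ C, IsContinuum A ∧ x ∈ A ∧
      (∀ i, a ≤ i → i ≤ b → ∀ z ∈ A, dist ((f ^ i) x) ((f ^ i) z) ≤ r) ∧
      ∃ i, a ≤ i ∧ i ≤ b ∧ ∃ z ∈ A, dist ((f ^ i) x) ((f ^ i) z) = r := by
  have hne : (Finset.Icc a b).Nonempty := ⟨j, Finset.mem_Icc.2 ⟨haj, hjb⟩⟩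
  let g : X → ℝ := fun z => (Finset.Icc a b).sup' hne fun i => dist ((f ^ i) x) ((f ^ i) z)
  have hg : Continuous g := Continuous.finset_sup'_apply hne fun i _ =>
    continuous_const.dist (f ^ i).continuous
  have hgi : ∀ i, a ≤ i → i ≤ b → ∀ z, dist ((f ^ i) x) ((f ^ i) z) ≤ g z := fun i ha hb z =>
    Finset.le_sup' (fun i => dist ((f ^ i) x) ((f ^ i) z)) (Finset.mem_Icc.2 ⟨ha, hb⟩)
  obtain ⟨A, hAC, hA, hxA, hle, z, hzA, hz⟩ := hC.exists_subcontinuum_level hg hx (r := r)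
    (Finset.sup'_le _ _ fun i _ => by rw [dist_self]; exact hr) hy (hxy.trans (hgi j haj hjb y))
  refine ⟨A, hAC, hA, hxA, fun i ha hb w hw => (hgi i ha hb w).trans (hle w hw), ?_⟩
  obtain ⟨i, hi, hig⟩ := Finset.exists_mem_eq_sup' hne fun i => dist ((f ^ i) x) ((f ^ i) z)
  rw [Finset.mem_Icc] at hi
  exact ⟨i, hi.1, hi.2, z, hzA, hig.symm.trans hz⟩

variable [CompactSpace X]

/-- Continua of definite size become large within a uniformly bounded time. -/
lemma IsCWConstant.exists_time (h : IsCWConstant f α) {γ : ℝ} (hγ : 0 < γ) :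
    ∃ N : ℕ, ∀ C : Set X, IsContinuum C → ∀ m : ℤ,
      (∃ x ∈ C, ∃ y ∈ C, γ ≤ dist ((f ^ m) x) ((f ^ m) y)) →
      ∃ n : ℤ, m - N ≤ n ∧ n ≤ m + N ∧ ¬ SmallAt f C α n := by
  suffices H : ∃ N : ℕ, ∀ C : Set X, IsContinuum C → (∃ x ∈ C, ∃ y ∈ C, γ ≤ dist x y) →
      ∃ n : ℤ, -N ≤ n ∧ n ≤ N ∧ ¬ SmallAt f C α n by
    obtain ⟨N, hN⟩ := H
    refine ⟨N, fun C hC m ⟨x, hx, y, hy, hd⟩ => ?_⟩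
    obtain ⟨n, h1, h2, h3⟩ := hN _ (hC.image (f ^ m).continuous)
      ⟨_, mem_image_of_mem _ hx, _, mem_image_of_mem _ hy, hd⟩
    rw [smallAt_image_iff] at h3
    exact ⟨n + m, by linarith, by linarith, h3⟩
  by_contra hcon
  push Not at hcon
  choose C hC hfar hsm using hcon
  obtain ⟨K, φ, hφ, hK, hlim⟩ := exists_subseq_hausdorffLim C hC
  obtain ⟨x, hx, y, hy, hd⟩ := hlim.exists_far hγ fun n => hfar (φ n)
  have hnt : K.Nontrivial := ⟨x, hx, y, hy, fun he => by
    rw [he, dist_self] at hd; linarith⟩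
  obtain ⟨n, hn⟩ := h.2 K hK hnt
  refine hn (hlim.smallAt (fun n => (hC _).2.1) ?_)
  filter_upwards [eventually_ge_atTop n.natAbs] with k hk
  have := hφ.id_le k
  simp only [id] at this
  exact hsm (φ k) n (by omega) (by omega)

/-- A continuum that is small at two times is small at all times in between. -/
lemma IsCWConstant.exists_smallAt_between (h : IsCWConstant f α) {ε : ℝ} (hε : 0 < ε)
    (hεα : ε ≤ α) : ∃ δ > 0, ∀ C : Set X, IsContinuum C → ∀ a b : ℤ, SmallAt f C δ a →
      SmallAt f C δ b → ∀ j, a ≤ j → j ≤ b → SmallAt f C ε j := by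
  by_contra hcon
  push Not at hcon
  have hstep : ∀ k : ℕ, ∃ (B : Set X) (a b : ℤ), IsContinuum B ∧ a ≤ 0 ∧ 0 ≤ b ∧
      (∃ x ∈ B, ∃ y ∈ B, ε / 2 ≤ dist x y) ∧ SmallAt f B (1 / (k + 1)) a ∧
      SmallAt f B (1 / (k + 1)) b ∧ ∀ i, a ≤ i → i ≤ b → SmallAt f B ε i := by
    intro k
    obtain ⟨C, hC, a, b, ha, hb, j, haj, hjb, hj⟩ := hcon (1 / (k + 1)) Nat.one_div_pos_of_nat
    rw [SmallAt] at hj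
    push Not at hj
    obtain ⟨x, hx, y, hy, hxy⟩ := hj
    obtain ⟨A, hAC, hA, hxA, hle, i, hai, hib, z, hz, hzr⟩ :=
      exists_subcontinuum_orbit_level f hC hx hy haj hjb (r := ε / 2) (half_pos hε).le (by linarith)
    refine ⟨(f ^ i) '' A, a - i, b - i, hA.image (f ^ i).continuous, by linarith, by linarith,
      ⟨_, mem_image_of_mem _ hxA, _, mem_image_of_mem _ hz, hzr.ge⟩, ?_, ?_, ?_⟩
    · rw [smallAt_image_iff, sub_add_cancel]
      exact ha.mono hAC le_rfl
    · rw [smallAt_image_iff, sub_add_cancel]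
      exact hb.mono hAC le_rfl
    · intro l hl1 hl2
      rw [smallAt_image_iff]
      intro u hu v hv
      have h1 := hle (l + i) (by linarith) (by linarith) u hu
      have h2 := hle (l + i) (by linarith) (by linarith) v hv
      rw [dist_comm] at h1
      linarith [dist_triangle ((f ^ (l + i)) u) ((f ^ (l + i)) x) ((f ^ (l + i)) v)]
  choose B a b hB ha hb hfar hsa hsb hsm using hstep
  obtain ⟨K, φ, hφ, hK, hlim⟩ := exists_subseq_hausdorffLim B hB
  obtain ⟨x, hx, y, hy, hd⟩ := hlim.exists_far (half_pos hε) fun n => hfar (φ n)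
  have hnt : K.Nontrivial := ⟨x, hx, y, hy, fun he => by
    rw [he, dist_self] at hd; linarith⟩
  obtain ⟨n, hn⟩ := h.2 K hK hnt
  -- By uniform continuity of `f ^ (-m)`, a set that is small at a fixed time `m` is small at time
  -- 0, so the times `a k` and `b k` leave every bounded interval.
  have hm : ∀ m : ℤ, ∀ᶠ k in atTop, ¬ SmallAt f (B k) (1 / (k + 1)) m := by
    intro m
    obtain ⟨η, hη, huc⟩ := Metric.uniformContinuous_iff.1
      (CompactSpace.uniformContinuous_of_continuous (f ^ (-m)).continuous) (ε / 2) (half_pos hε)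
    filter_upwards [(tendsto_one_div_add_atTop_nhds_zero_nat (𝕜 := ℝ)).eventually_lt_const hη]
      with k hk hs
    obtain ⟨x, hx, y, hy, hd⟩ := hfar k
    have := huc (lt_of_le_of_lt (hs x hx y hy) hk)
    rw [zpow_neg_apply_zpow_apply, zpow_neg_apply_zpow_apply] at this
    linarith
  have hall : ∀ᶠ k in atTop, ∀ m ∈ Finset.Icc (-|n|) |n|, ¬ SmallAt f (B k) (1 / (k + 1)) m :=
    (Filter.eventually_all_finset _).2 fun m _ => hm m
  refine hn (hlim.smallAt (fun n => (hB _).2.1) ?_)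
  filter_upwards [hφ.tendsto_atTop.eventually hall] with k hk
  have h1 : a (φ k) < -|n| := by
    by_contra hlt
    exact hk _ (Finset.mem_Icc.2 ⟨not_lt.1 hlt, (ha _).trans (abs_nonneg n)⟩) (hsa _)
  have h2 : |n| < b (φ k) := by
    by_contra hlt
    exact hk _ (Finset.mem_Icc.2 ⟨by linarith [hb (φ k), abs_nonneg n], not_lt.1 hlt⟩) (hsb _)
  exact (hsm (φ k) n (by linarith [neg_abs_le n]) (by linarith [le_abs_self n])).mono subset_rfl hεα

/-- Continua that stay small in the future shrink, uniformly. -/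
lemma IsCWConstant.exists_smallAt_of_forall (h : IsCWConstant f α) {η : ℝ} (hη : 0 < η) :
    ∃ N : ℕ, ∀ C : Set X, IsContinuum C → ∀ a n : ℤ, (∀ j, a ≤ j → SmallAt f C α j) → a + N ≤ n →
      SmallAt f C η n := by
  obtain ⟨N, hN⟩ := h.exists_time hη
  refine ⟨N, fun C hC a n ha han x hx y hy => ?_⟩
  by_contra hlt
  obtain ⟨k, h1, -, h3⟩ := hN C hC n ⟨x, hx, y, hy, (not_le.1 hlt).le⟩
  exact h3 (ha k (by linarith))

variable [LocallyConnectedSpace X] [ConnectedSpace X] [Nontrivial X]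

/-- There are no Lyapunov stable points: the forward iterates of every nonempty open set become
large. If those of `U` stayed small, small continua at `f ^ (-n) y`, for `y` well inside `U`, would
be mapped into `U` by `f ^ n` and would be contracted by it. Then the number of points in `U` would
be bounded by the number of small balls that cover `X`. -/
lemma IsCWConstant.exists_not_smallAt_of_isOpen (h : IsCWConstant f α) {U : Set X} (hU : IsOpen U)
    (hne : U.Nonempty) : ∃ n : ℕ, ¬ SmallAt f U α n := by
  by_contra hcon
  push Not at hcon
  obtain ⟨x₀, hx₀⟩ := hne
  obtain ⟨s, hs, hsU⟩ := Metric.isOpen_iff.1 hU x₀ hx₀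
  obtain ⟨N, hN⟩ := h.exists_time (γ := s / 4) (by positivity)
  obtain ⟨δ, hδ, hbet⟩ := h.exists_smallAt_between h.1 le_rfl
  obtain ⟨M, hM⟩ := h.exists_smallAt_of_forall hδ
  obtain ⟨δ', hδ', hulc⟩ := exists_uniform_small_continuum (X := X) hδ
  have hfwd : ∀ (T : Set X) (n : ℕ), (f ^ (n : ℤ)) '' T ⊆ U → ∀ j : ℤ, n ≤ j →
      SmallAt f T α j := by
    intro T n hT j hj
    have := (hcon (j - n).toNat).mono hT le_rfl
    rw [smallAt_image_iff] at this
    have he : (((j - n).toNat : ℕ) : ℤ) + n = j := by omega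
    rwa [he] at this
  -- Small continua that start at `f ^ (-n) y` are mapped into `U` by `f ^ n`, and shrink.
  have hinto : ∀ y ∈ Metric.ball x₀ (s / 2), ∀ n : ℕ, N ≤ n → ∀ T : Set X, IsContinuum T →
      (f ^ (-(n : ℤ))) y ∈ T → (∀ a ∈ T, ∀ b ∈ T, dist a b ≤ δ) →
      ∀ j : ℤ, 0 ≤ j → SmallAt f T α j := by
    intro y hy n hn T hT hyT hTδ
    have hT0 : SmallAt f T δ 0 := smallAt_zero_iff.2 hTδ
    have key : ∀ D ⊆ T, IsContinuum D → (f ^ (n : ℤ)) '' D ⊆ U → ∀ j : ℤ, 0 ≤ j →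
        SmallAt f D α j := by
      intro D hDT hD hDU j hj
      have h1 := hfwd D n hDU
      have h2 : SmallAt f D δ (n + M) := hM D hD n (n + M) h1 le_rfl
      rcases le_total j (n + M) with hjn | hjn
      · exact hbet D hD 0 (n + M) (hT0.mono hDT le_rfl) h2 j hj hjn
      · exact h1 j (by linarith)
    refine key T subset_rfl hT ?_
    rintro _ ⟨z, hz, rfl⟩
    refine hsU (Metric.mem_ball.2 ?_)
    by_contra hfar
    have hyfar : s / 4 ≤ dist ((f ^ (n : ℤ)) ((f ^ (-(n : ℤ))) y)) ((f ^ (n : ℤ)) z) := by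
      rw [zpow_apply_zpow_neg_apply, dist_comm]
      have := dist_triangle ((f ^ (n : ℤ)) z) y x₀
      rw [Metric.mem_ball] at hy
      linarith
    obtain ⟨D, hDT, hD, hyD, hle, i, hi1, hi2, w, hw, hwr⟩ := exists_subcontinuum_orbit_level f hT
      hyT hz (a := n) (b := n) le_rfl le_rfl (r := s / 4) (by positivity) hyfar
    obtain rfl : i = n := le_antisymm hi2 hi1
    have hDU : (f ^ (n : ℤ)) '' D ⊆ U := by
      rintro _ ⟨v, hv, rfl⟩
      refine hsU (Metric.mem_ball.2 ?_)
      have h1 := hle n le_rfl le_rfl v hv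
      rw [zpow_apply_zpow_neg_apply, dist_comm] at h1
      rw [Metric.mem_ball] at hy
      linarith [dist_triangle ((f ^ (n : ℤ)) v) y x₀]
    obtain ⟨k, hk1, -, hk3⟩ := hN D hD n ⟨_, hyD, w, hw, hwr.ge⟩
    exact hk3 (key D hDT hD hDU k (by omega))
  -- Among more points of `U` than there are balls of radius `δ' / 2` in a cover of `X`, two have
  -- `n`-th preimages in the same ball.
  obtain ⟨t, htf, ht⟩ := Metric.totallyBounded_iff.1 (isCompact_univ (X := X)).totallyBounded
    (δ' / 2) (half_pos hδ')
  have hinf : (Metric.ball x₀ (s / 2)).Infinite :=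
    infinite_of_mem_nhds x₀ (Metric.ball_mem_nhds x₀ (half_pos hs))
  obtain ⟨F, hF, hFc⟩ := hinf.exists_subset_card_eq (max 2 (htf.toFinset.card + 1))
  have hFnt : (F : Set X).Nontrivial := by
    have : 1 < F.card := by omega
    exact Finset.one_lt_card_iff_nontrivial.1 this
  have hη : 0 < (F : Set X).infsep := (Set.Finite.infsep_pos_iff_nontrivial F.finite_toSet).2 hFnt
  obtain ⟨N', hN'⟩ := h.exists_smallAt_of_forall (half_pos hη)
  set n := max N N' with hn
  have hcov : ∀ z : X, ∃ c ∈ htf.toFinset, dist z c < δ' / 2 := by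
    intro z
    obtain ⟨c, hc, hz⟩ := mem_iUnion₂.1 (ht (mem_univ z))
    exact ⟨c, htf.mem_toFinset.2 hc, hz⟩
  choose g hgt hgd using hcov
  obtain ⟨y, hy, y', hy', hyy', hg⟩ := Finset.exists_ne_map_eq_of_card_lt_of_maps_to
    (s := F) (t := htf.toFinset) (by omega) (f := fun y => g ((f ^ (-(n : ℤ))) y))
    (fun y _ => hgt _)
  have hd : dist ((f ^ (-(n : ℤ))) y) ((f ^ (-(n : ℤ))) y') < δ' := by
    have h1 := hgd ((f ^ (-(n : ℤ))) y)
    have h2 := hgd ((f ^ (-(n : ℤ))) y')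
    rw [← hg, dist_comm] at h2
    linarith [dist_triangle ((f ^ (-(n : ℤ))) y) (g ((f ^ (-(n : ℤ))) y)) ((f ^ (-(n : ℤ))) y')]
  obtain ⟨T, hT, hyT, hyT', hTδ⟩ := hulc _ _ hd
  have hsm := hN' T hT 0 n (hinto y (hF hy) n (le_max_left _ _) T hT hyT hTδ)
    (by rw [zero_add]; exact_mod_cast le_max_right N N') _ hyT _ hyT'
  rw [zpow_apply_zpow_neg_apply, zpow_apply_zpow_neg_apply] at hsm
  have := Set.infsep_le_dist_of_mem (Finset.mem_coe.2 hy) (Finset.mem_coe.2 hy') hyy'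
  linarith

/-- Every point lies on a stable continuum of uniform size. The backward iterates of a small
neighbourhood of `f ^ n x` become large within uniformly bounded time; cutting them down by boundary
bumping and pulling them back to `x` gives continua through `x` that stay small during `[0, n]`
without being small themselves, and one passes to the limit. -/
lemma IsCWConstant.exists_stable_continuum (h : IsCWConstant f α) {ρ : ℝ} (hρ : 0 < ρ)
    (hρα : 2 * ρ ≤ α) : ∃ δ > 0, ∀ x : X, ∃ A : Set X, IsContinuum A ∧ x ∈ A ∧
      (∃ y ∈ A, ∃ z ∈ A, δ ≤ dist y z) ∧ ∀ n : ℕ, SmallAt f A (2 * ρ) n := by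
  obtain ⟨δ, hδ, hbet⟩ := h.exists_smallAt_between (ε := ρ / 2) (by positivity) (by linarith)
  let W : X → Set X := fun x => connectedComponentIn (Metric.ball x (δ / 2)) x
  have hWo : ∀ x, IsOpen (W x) := fun x => Metric.isOpen_ball.connectedComponentIn
  have hWx : ∀ x, x ∈ W x := fun x =>
    mem_connectedComponentIn (Metric.mem_ball_self (half_pos hδ))
  have hWc : ∀ x, IsContinuum (closure (W x)) := fun x =>
    ⟨isClosed_closure.isCompact, ⟨x, subset_closure (hWx x)⟩,
      isPreconnected_connectedComponentIn.closure⟩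
  have hWδ : ∀ x, ∀ a ∈ closure (W x), ∀ b ∈ closure (W x), dist a b ≤ δ := by
    intro x a ha b hb
    have hsub : closure (W x) ⊆ Metric.closedBall x (δ / 2) :=
      closure_minimal ((connectedComponentIn_subset _ _).trans Metric.ball_subset_closedBall)
        Metric.isClosed_closedBall
    have h1 := Metric.mem_closedBall.1 (hsub ha)
    have h2 := Metric.mem_closedBall'.1 (hsub hb)
    linarith [dist_triangle a x b]
  choose k hk using fun x => h.inv.exists_not_smallAt_of_isOpen (hWo x) ⟨x, hWx x⟩
  obtain ⟨t, ht⟩ := isCompact_univ.elim_finite_subcover W hWo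
    (fun x _ => mem_iUnion.2 ⟨x, hWx x⟩)
  refine ⟨δ / 2, half_pos hδ, fun x => ?_⟩
  have hstep : ∀ n : ℕ, ∃ A : Set X, IsContinuum A ∧ x ∈ A ∧
      (∃ y ∈ A, ∃ z ∈ A, δ ≤ dist y z) ∧
      ∀ i : ℕ, i ≤ n → SmallAt f A (2 * ρ) i := by
    intro n'
    obtain ⟨n, hnn', hnk⟩ : ∃ n : ℕ, n' ≤ n ∧ ∀ c ∈ t, k c ≤ n :=
      ⟨max n' (t.sup k), le_max_left _ _, fun c hc => (Finset.le_sup hc).trans (le_max_right _ _)⟩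
    obtain ⟨c, hct, hxc⟩ := mem_iUnion₂.1 (ht (mem_univ ((f ^ (n : ℤ)) x)))
    have hkc := hk c
    have hp : ∃ p ∈ W c,
        ρ ≤ dist ((f ^ (-(k c : ℤ))) ((f ^ (n : ℤ)) x)) ((f ^ (-(k c : ℤ))) p) := by
      by_contra hcon
      push Not at hcon
      refine hkc (smallAt_inv_iff.2 fun u hu v hv => ?_)
      have h1 := hcon u hu
      have h2 := hcon v hv
      rw [dist_comm] at h1
      linarith [dist_triangle ((f ^ (-(k c : ℤ))) u) ((f ^ (-(k c : ℤ))) ((f ^ (n : ℤ)) x))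
        ((f ^ (-(k c : ℤ))) v)]
    obtain ⟨p, hp, hpρ⟩ := hp
    obtain ⟨A, hAW, hA, hxA, hle, i, hi1, hi2, z, hz, hzr⟩ := exists_subcontinuum_orbit_level f
      (hWc c) (subset_closure hxc) (subset_closure hp) (a := -n) (b := 0)
      (by have := hnk c hct; omega) (by omega) hρ.le hpρ
    have hsm : ∀ j : ℤ, -n ≤ j → j ≤ 0 → SmallAt f A (2 * ρ) j := by
      intro j hj1 hj2 u hu v hv
      have h1 := hle j hj1 hj2 u hu
      have h2 := hle j hj1 hj2 v hv
      rw [dist_comm] at h1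
      linarith [dist_triangle ((f ^ j) u) ((f ^ j) ((f ^ (n : ℤ)) x)) ((f ^ j) v)]
    refine ⟨(f ^ (-(n : ℤ))) '' A, hA.image (f ^ (-(n : ℤ))).continuous,
      ⟨_, hxA, zpow_neg_apply_zpow_apply f n x⟩, ?_, fun j hj => ?_⟩
    · by_contra hcon
      push Not at hcon
      have h0 : SmallAt f A δ (-n) := by
        rw [← zero_add (-(n : ℤ)), ← smallAt_image_iff, smallAt_zero_iff]
        exact fun u hu v hv => (hcon u hu v hv).le
      have h1 : SmallAt f A δ 0 :=
        smallAt_zero_iff.2 fun u hu v hv => hWδ c u (hAW hu) v (hAW hv)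
      have := hbet A hA (-n) 0 h0 h1 i hi1 hi2 _ hxA _ hz
      linarith
    · rw [smallAt_image_iff]
      exact hsm _ (by omega) (by omega)
  choose A hA hxA hfar hsm using hstep
  obtain ⟨K, φ, hφ, hK, hlim⟩ := exists_subseq_hausdorffLim A hA
  refine ⟨K, hK, ?_, hlim.exists_far hδ fun n => hfar (φ n), fun n => ?_⟩
  · exact hlim.mem_of_tendsto hK.1.isClosed (w := fun _ => x) (Eventually.of_forall fun n => hxA _)
      tendsto_const_nhds
  · refine hlim.smallAt (fun n => (hA _).2.1) ?_
    filter_upwards [eventually_ge_atTop n] with l hl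
    exact hsm (φ l) n (hl.trans (hφ.id_le l))

end Dynamics

/-! ### Order and continua of convergence -/

section Order

variable {X : Type*} [MetricSpace X] {f : X ≃ₜ X} {α : ℝ}

/-- The points whose forward orbit stays within `c` of the forward orbit of `b`. -/
def stableSet (f : X ≃ₜ X) (c : ℝ) (b : X) : Set X :=
  {z | ∀ n : ℕ, dist ((f ^ (n : ℤ)) z) ((f ^ (n : ℤ)) b) ≤ c}

lemma isClosed_stableSet (f : X ≃ₜ X) (c : ℝ) (b : X) : IsClosed (stableSet f c b) := by
  simp only [stableSet, ofPred_forall]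
  exact isClosed_iInter fun n => isClosed_le ((f ^ (n : ℤ)).continuous.dist continuous_const)
    continuous_const

lemma SmallAt.mem_stableSet {A : Set X} {c : ℝ} (hA : ∀ n : ℕ, SmallAt f A c n) {x y : X}
    (hx : x ∈ A) (hy : y ∈ A) : x ∈ stableSet f c y := fun n => hA n x hx y hy

lemma stableSet_trans {c d : ℝ} {x y z : X} (hxz : z ∈ stableSet f c x)
    (hyz : z ∈ stableSet f d y) :
    x ∈ stableSet f (c + d) y := by
  intro n
  have h1 := hxz n
  have h2 := hyz n
  rw [dist_comm] at h1
  linarith [dist_triangle ((f ^ (n : ℤ)) x) ((f ^ (n : ℤ)) z) ((f ^ (n : ℤ)) y)]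

variable [CompactSpace X] [LocallyConnectedSpace X] [ConnectedSpace X] [Nontrivial X]

lemma IsCWConstant.interior_stableSet (h : IsCWConstant f α) {c : ℝ} (hc : 2 * c ≤ α) (b : X) :
    interior (stableSet f c b) = ∅ := by
  by_contra hne
  obtain ⟨n, hn⟩ := h.exists_not_smallAt_of_isOpen isOpen_interior
    (nonempty_iff_ne_empty.2 hne)
  refine hn fun x hx y hy => ?_
  have h1 := interior_subset hx n
  have h2 := interior_subset hy n
  rw [dist_comm] at h2
  linarith [dist_triangle ((f ^ (n : ℤ)) x) ((f ^ (n : ℤ)) b) ((f ^ (n : ℤ)) y)]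

/-- Small neighbourhoods have uncountable boundary: every stable continuum of definite size through
a point of `U` leaves `U`, so the stable sets of the points of the boundary cover `U`; these are
closed with empty interior, and Baire's theorem applies. -/
lemma IsCWConstant.exists_radius_not_countable_frontier (h : IsCWConstant f α) :
    ∃ r > 0, ∀ (x : X) (U : Set X), IsOpen U → x ∈ U → U ⊆ Metric.ball x r →
      ¬ (frontier U).Countable := by
  have hα := h.1
  obtain ⟨δ, hδ, hA⟩ := h.exists_stable_continuum (ρ := α / 4) (by positivity) (by linarith)
  refine ⟨δ / 2, half_pos hδ, fun x U hU hxU hUr hcount => ?_⟩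
  have hmeet : ∀ y ∈ U, ∃ b ∈ frontier U, y ∈ stableSet f (2 * (α / 4)) b := by
    intro y hy
    obtain ⟨A, hAc, hyA, ⟨p, hp, q, hq, hpq⟩, hsm⟩ := hA y
    by_contra hcon
    push Not at hcon
    have hAU : A ⊆ U := by
      refine hAc.2.isPreconnected.subset_of_closure_inter_subset hU ⟨y, hyA, hy⟩ ?_
      rintro z ⟨hz, hzA⟩
      by_contra hzU
      exact hcon z ⟨hz, by rwa [hU.interior_eq]⟩ (SmallAt.mem_stableSet hsm hyA hzA)
    have h1 := Metric.mem_ball.1 (hUr (hAU hp))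
    have h2 := Metric.mem_ball'.1 (hUr (hAU hq))
    linarith [dist_triangle p x q]
  let S : Set (Option X) := insert none (some '' frontier U)
  let F : Option X → Set X := fun o => o.elim Uᶜ (stableSet f (2 * (α / 4)))
  have hd : Dense (⋃ o ∈ S, interior (F o)) := by
    refine dense_biUnion_interior_of_closed ?_ ((hcount.image _).insert _) ?_
    · rintro (_ | b) -
      · exact hU.isClosed_compl
      · exact isClosed_stableSet _ _ _
    · refine eq_univ_of_forall fun y => ?_
      by_cases hy : y ∈ U
      · obtain ⟨b, hb, hyb⟩ := hmeet y hy
        exact mem_iUnion₂.2 ⟨some b, Or.inr ⟨b, hb, rfl⟩, hyb⟩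
      · exact mem_iUnion₂.2 ⟨none, Or.inl rfl, hy⟩
  obtain ⟨z, hzU, hz⟩ := hd.inter_open_nonempty U hU ⟨x, hxU⟩
  obtain ⟨o, -, ho⟩ := mem_iUnion₂.1 hz
  rcases o with _ | b
  · exact interior_subset ho hzU
  · have : z ∈ interior (stableSet f (2 * (α / 4)) b) := ho
    rw [h.interior_stableSet (by linarith)] at this
    exact this

lemma IsCWConstant.nowhereRimCountable (h : IsCWConstant f α) : NowhereRimCountable X := by
  obtain ⟨r, hr, hU⟩ := h.exists_radius_not_countable_frontier
  intro x hx
  obtain ⟨U, hUo, hxU, hUr, hc⟩ := hx _ (Metric.ball_mem_nhds x hr)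
  exact hU x U hUo hxU hUr hc

lemma IsCWConstant.order_eq_continuum (h : IsCWConstant f α) (x : X) : order x = 𝔠 := by
  have hX : #X ≤ 𝔠 := by
    have hinj : Function.Injective
        fun x : X => {B : TopologicalSpace.countableBasis X | x ∈ (B : Set X)} := by
      intro x y hxy
      refine ((TopologicalSpace.isBasis_countableBasis X).inseparable_iff.2 fun B hB => ?_).eq
      exact Set.ext_iff.1 hxy ⟨B, hB⟩
    refine (Cardinal.mk_le_of_injective hinj).trans ?_
    rw [Cardinal.mk_set, ← Cardinal.two_power_aleph0]
    exact Cardinal.power_le_power_left two_ne_zero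
      (Cardinal.mk_le_aleph0_iff.2 (TopologicalSpace.countable_countableBasis X).to_subtype)
  refine le_antisymm (csInf_le' fun V hV => ?_) (le_csInf ⟨𝔠, fun V hV => ?_⟩ fun κ hκ => ?_)
  · obtain ⟨U, hUV, hU, hxU⟩ := mem_nhds_iff.1 hV
    exact ⟨U, hU, hxU, hUV, (Cardinal.mk_set_le _).trans hX⟩
  · obtain ⟨U, hUV, hU, hxU⟩ := mem_nhds_iff.1 hV
    exact ⟨U, hU, hxU, hUV, (Cardinal.mk_set_le _).trans hX⟩
  · obtain ⟨r, hr, hU⟩ := h.exists_radius_not_countable_frontier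
    obtain ⟨U, hUo, hxU, hUr, hc⟩ := hκ _ (Metric.ball_mem_nhds x hr)
    obtain ⟨g, hgU, -, hg⟩ :=
      isClosed_frontier.exists_nat_bool_injection_of_not_countable (hU x U hUo hxU hUr)
    refine le_trans ?_ hc
    have := Cardinal.mk_le_of_injective (f := fun a : ULift (ℕ → Bool) =>
      (⟨g a.down, hgU (mem_range_self _)⟩ : frontier U))
      (fun a b hab => ULift.down_injective (hg (Subtype.ext_iff.1 hab)))
    simpa using this

/-- Every point lies in a continuum of convergence. Choose points `y n` converging to `x`, each
outside the stable sets of `x` and of the previous points, which is possible because those have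
empty interior. The stable continua through the `y n` are then disjoint from each other and from
the limit of a convergent subsequence. -/
lemma IsCWConstant.exists_isContinuumOfConvergence (h : IsCWConstant f α) (x : X) :
    ∃ K : Set X, x ∈ K ∧ IsContinuumOfConvergence K := by
  have hα := h.1
  obtain ⟨ρ, hρ, hρα⟩ : ∃ ρ > 0, 8 * ρ ≤ α := ⟨α / 8, by positivity, by linarith⟩
  obtain ⟨δ, hδ, hA⟩ := h.exists_stable_continuum hρ (by linarith)
  choose A hAc hxA hfar hsm using hA
  have hnext : ∀ (t : Finset X) (n : ℕ), ∃ y ∈ Metric.ball x (1 / (n + 1)),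
      ∀ b ∈ t, y ∉ stableSet f (2 * ρ + 2 * ρ) b := by
    intro t n
    have hd : Dense (⋂ b ∈ t, (stableSet f (2 * ρ + 2 * ρ) b)ᶜ) :=
      dense_biInter_of_isOpen (fun b _ => (isClosed_stableSet _ _ _).isOpen_compl)
        t.countable_toSet
        (fun b _ => interior_eq_empty_iff_dense_compl.1 (h.interior_stableSet (by linarith) b))
    obtain ⟨y, hy, hyt⟩ := hd.inter_open_nonempty _ Metric.isOpen_ball
      ⟨x, Metric.mem_ball_self (Nat.one_div_pos_of_nat (n := n))⟩
    exact ⟨y, hy, fun b hb => mem_iInter₂.1 hyt b hb⟩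
  obtain ⟨u, huP, hur⟩ := exists_seq_of_forall_finset_exists
    (fun p : ℕ × X => p.2 ∈ Metric.ball x (1 / (p.1 + 1)) ∧ p.2 ∉ stableSet f (2 * ρ + 2 * ρ) x)
    (fun p q => p.1 < q.1 ∧ q.2 ∉ stableSet f (2 * ρ + 2 * ρ) p.2) (fun s _ => by
      classical
      obtain ⟨y, hy, hyt⟩ := hnext (insert x (s.image Prod.snd)) (s.sup Prod.fst + 1)
      refine ⟨(s.sup Prod.fst + 1, y), ⟨hy, hyt x (Finset.mem_insert_self _ _)⟩, fun p hp =>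
        ⟨Nat.lt_succ_of_le (Finset.le_sup (f := Prod.fst) hp),
          hyt _ (Finset.mem_insert_of_mem (Finset.mem_image_of_mem _ hp))⟩⟩)
  have hmono : StrictMono fun n => (u n).1 := fun m n hmn => (hur m n hmn).1
  have hux : Tendsto (fun n => (u n).2) atTop (𝓝 x) := by
    refine tendsto_iff_dist_tendsto_zero.2 (squeeze_zero (fun _ => dist_nonneg)
      (fun n => (Metric.mem_ball.1 (huP n).1).le) ?_)
    exact (tendsto_one_div_add_atTop_nhds_zero_nat (𝕜 := ℝ)).comp hmono.tendsto_atTop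
  obtain ⟨K, φ, hφ, hK, hlim⟩ := exists_subseq_hausdorffLim (fun n => A (u n).2) fun n => hAc _
  have hxK : x ∈ K := hlim.mem_of_tendsto hK.1.isClosed (w := fun n => (u (φ n)).2)
    (Eventually.of_forall fun n => hxA _) (hux.comp hφ.tendsto_atTop)
  have hKsm : ∀ n : ℕ, SmallAt f K (2 * ρ) n := fun n =>
    hlim.smallAt (fun n => (hAc _).2.1) (Eventually.of_forall fun k => hsm _ n)
  have hdisj : ∀ m n, m < n → Disjoint (A (u m).2) (A (u n).2) := by
    refine fun m n hmn => disjoint_left.2 fun z hzm hzn => (hur m n hmn).2 ?_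
    exact stableSet_trans (SmallAt.mem_stableSet (hsm _) hzn (hxA _))
      (SmallAt.mem_stableSet (hsm _) hzm (hxA _))
  refine ⟨K, hxK, hK, ?_, fun n => A (u (φ n)).2, fun n => hAc _, fun n => ?_, fun m n hmn => ?_,
    hlim.tendsto⟩
  · obtain ⟨p, hp, q, hq, hpq⟩ := hlim.exists_far hδ fun n => hfar _
    refine ⟨p, hp, q, hq, fun he => ?_⟩
    rw [he, dist_self] at hpq
    linarith
  · refine disjoint_left.2 fun z hzn hzK => (huP (φ n)).2 ?_
    exact stableSet_trans (SmallAt.mem_stableSet (hsm _) hzn (hxA _))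
      (SmallAt.mem_stableSet hKsm hzK hxK)
  · rcases lt_or_gt_of_ne hmn with hlt | hlt
    · exact hdisj _ _ (hφ hlt)
    · exact (hdisj _ _ (hφ hlt)).symm

end Order

/-! ### Local cut points -/

section RimCountable

variable {X : Type*} [MetricSpace X] [CompactSpace X]

/-- If near `p` every other point lies in an open set that avoids `p` and has a single boundary
point, different from `p`, then finitely many such sets cover a small sphere about `p`, and removing
them from the ball leaves a neighbourhood of `p` with finite boundary. -/
lemma isRimCountableAt_of_forall_exists_isOpen {p : X} {V : Set X} (hV : IsOpen V) (hp : p ∈ V)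
    (h : ∀ w ∈ V, w ≠ p → ∃ (B : Set X) (r : X), IsOpen B ∧ w ∈ B ∧ p ∉ B ∧ r ≠ p ∧
      V ∩ closure B ⊆ insert r B) : IsRimCountableAt p := by
  intro N hN
  obtain ⟨ε, hε, hεV⟩ := Metric.nhds_basis_closedBall.mem_iff.1 (inter_mem (hV.mem_nhds hp) hN)
  set O := Metric.ball p ε with hO
  have hclO : closure O ⊆ Metric.closedBall p ε := Metric.closure_ball_subset_closedBall
  have hpO : p ∈ O := Metric.mem_ball_self hε
  have hOo : IsOpen O := Metric.isOpen_ball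
  have : Nonempty X := ⟨p⟩
  choose! B r hBo hwB hpB hrp hBr using h
  have hfrV : ∀ w ∈ frontier O, w ∈ V ∧ w ≠ p := by
    intro w hw
    refine ⟨(hεV (hclO hw.1)).1, fun he => hw.2 ?_⟩
    rwa [hOo.interior_eq, he]
  obtain ⟨t, htO, htf, ht⟩ := (isClosed_frontier (s := O)).isCompact.elim_finite_subcover_image
    (b := frontier O) (c := B) (fun w hw => hBo w (hfrV w hw).1 (hfrV w hw).2)
    (fun w hw => mem_iUnion₂.2 ⟨w, hw, hwB w (hfrV w hw).1 (hfrV w hw).2⟩)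
  have hB : ∀ w ∈ t, IsOpen (B w) ∧ p ∉ B w ∧ r w ≠ p ∧ V ∩ closure (B w) ⊆ insert (r w) (B w) := by
    intro w hw
    obtain ⟨h1, h2⟩ := hfrV w (htO hw)
    exact ⟨hBo w h1 h2, hpB w h1 h2, hrp w h1 h2, hBr w h1 h2⟩
  set W := O ∩ (⋃ w ∈ t, closure (B w))ᶜ with hW
  have hWo : IsOpen W :=
    hOo.inter (htf.isClosed_biUnion fun _ _ => isClosed_closure).isOpen_compl
  refine ⟨W, hWo, ⟨hpO, ?_⟩, ?_, ?_⟩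
  · intro hpc
    obtain ⟨w, hw, hpw⟩ := mem_iUnion₂.1 hpc
    obtain ⟨-, h2, h3, h4⟩ := hB w hw
    rcases h4 ⟨hp, hpw⟩ with h5 | h5
    · exact h3 h5.symm
    · exact h2 h5
  · exact fun z hz => (hεV (Metric.ball_subset_closedBall hz.1)).2
  refine (htf.image r).countable.mono fun z hz => ?_
  have hzO : z ∈ closure O := closure_mono inter_subset_left hz.1
  have hzB : ∀ w ∈ t, z ∉ B w := by
    intro w hw hzw
    obtain ⟨y, hyB, hyW⟩ := mem_closure_iff.1 hz.1 _ (hB w hw).1 hzw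
    exact hyW.2 (mem_iUnion₂.2 ⟨w, hw, subset_closure hyB⟩)
  have hzO' : z ∈ O := by
    by_contra hcon
    have : z ∈ frontier O := ⟨hzO, by rwa [hOo.interior_eq]⟩
    obtain ⟨w, hw, hzw⟩ := mem_iUnion₂.1 (ht this)
    exact hzB w hw hzw
  have hzW : z ∉ W := by
    have := hz.2
    rwa [hWo.interior_eq] at this
  have : z ∈ ⋃ w ∈ t, closure (B w) := by
    by_contra hcon
    exact hzW ⟨hzO', hcon⟩
  obtain ⟨w, hw, hzw⟩ := mem_iUnion₂.1 this
  rcases (hB w hw).2.2.2 ⟨(hεV (hclO hzO)).1, hzw⟩ with h5 | h5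
  · exact ⟨w, hw, h5.symm⟩
  · exact absurd h5 (hzB w hw)

end RimCountable

section Separation

variable {X : Type*} [TopologicalSpace X] {V : Set X} {p q a b : X}

/-- In a connected set `V`, a nonempty open part of `V \ {p}` with no other boundary point in `V`
than `p` does have `p` as a boundary point. -/
lemma mem_closure_of_closure_subset_insert {G : Set X} (hV : IsPreconnected V)
    (hp : p ∈ V) (hG : IsOpen G) (hGV : (V ∩ G).Nonempty) (hpG : p ∉ G)
    (hcl : V ∩ closure G ⊆ insert p G) : p ∈ closure G := by
  by_contra hcon
  refine hpG (hV.subset_of_closure_inter_subset hG hGV ?_ hp)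
  rintro z ⟨hz, hzV⟩
  rcases hcl ⟨hzV, hz⟩ with rfl | h
  · exact absurd hz hcon
  · exact h

/-- One side of a separation by `p`, together with `p`, is closed. -/
lemma inter_closure_subset_insert {A B : Set X} (hB : IsOpen B) (hd : Disjoint A B)
    (hV : V ⊆ insert p (A ∪ B)) : V ∩ closure A ⊆ insert p A := by
  rintro z ⟨hzV, hz⟩
  rcases hV hzV with h | h | h
  · exact Or.inl h
  · exact Or.inr h
  · obtain ⟨y, hyB, hyA⟩ := mem_closure_iff.1 hz B hB h
    exact absurd hyB (disjoint_left.1 hd hyA)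

/-- If `r` separates a connected set `Y ∋ r`, either side together with `r` is connected. -/
lemma isPreconnected_inter_insert {Y A B : Set X} {r : X} (hY : IsPreconnected Y) (hr : r ∈ Y)
    (hA : IsOpen A) (hB : IsOpen B) (hd : Disjoint A B) (hYr : Y ⊆ insert r (A ∪ B)) :
    IsPreconnected (Y ∩ insert r A) := by
  have key : ∀ u v : Set X, IsOpen u → IsOpen v → Y ∩ insert r A ⊆ u ∪ v → r ∈ u →
      (Y ∩ insert r A ∩ v).Nonempty → (Y ∩ insert r A ∩ (u ∩ v)).Nonempty := by
    rintro u v hu hv huv hru ⟨z, ⟨hzY, hz⟩, hzv⟩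
    rcases hz with rfl | hzA
    · exact ⟨z, ⟨hzY, Or.inl rfl⟩, hru, hzv⟩
    obtain ⟨y, hyY, hyu, hyv, hyA⟩ := hY (u ∪ B) (v ∩ A) (hu.union hB) (hv.inter hA) (by
      intro y hy
      rcases hYr hy with rfl | h | h
      · exact Or.inl (Or.inl hru)
      · rcases huv ⟨hy, Or.inr h⟩ with h' | h'
        · exact Or.inl (Or.inl h')
        · exact Or.inr ⟨h', h⟩
      · exact Or.inl (Or.inr h)) ⟨r, hr, Or.inl hru⟩ ⟨z, hzY, hzv, hzA⟩
    rcases hyu with h | h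
    · exact ⟨y, ⟨hyY, Or.inr hyA⟩, h, hyv⟩
    · exact absurd h (disjoint_left.1 hd hyA)
  intro u v hu hv huv hnu hnv
  rcases huv ⟨hr, Or.inl rfl⟩ with h | h
  · exact key u v hu hv huv h hnv
  · rw [inter_comm u v]
    exact key v u hv hu (by rwa [union_comm]) h hnu

/-- The component of `V \ {p}` that contains `a`; it is empty if `a ∉ V \ {p}`. -/
abbrev side (V : Set X) (a p : X) : Set X := connectedComponentIn (V \ {p}) a

/-- The points of `V` that separate `a` and `b` in `V`. -/
def separators (V : Set X) (a b : X) : Set X :=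
  {p | p ∈ V ∧ a ∈ V \ {p} ∧ b ∈ V \ {p} ∧ b ∉ side V a p}

lemma not_mem_side (V : Set X) (a p : X) : p ∉ side V a p :=
  fun h => (connectedComponentIn_subset _ _ h).2 rfl

lemma disjoint_side (h : b ∉ side V a p) : Disjoint (side V a p) (side V b p) := by
  refine disjoint_left.2 fun z hza hzb => h ?_
  have hb : b ∈ V \ {p} := connectedComponentIn_nonempty_iff.1 ⟨z, hzb⟩
  have he : side V a p = side V b p :=
    (connectedComponentIn_eq hza).trans (connectedComponentIn_eq hzb).symm
  rw [he]
  exact mem_connectedComponentIn hb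

lemma mem_separators_comm (h : p ∈ separators V a b) : p ∈ separators V b a :=
  ⟨h.1, h.2.2.1, h.2.1, fun ha =>
    disjoint_left.1 (disjoint_side h.2.2.2) (mem_connectedComponentIn h.2.1) ha⟩

variable [T1Space X] [LocallyConnectedSpace X]

lemma isOpen_side (hV : IsOpen V) (a p : X) : IsOpen (side V a p) :=
  (hV.sdiff isClosed_singleton).connectedComponentIn

lemma inter_closure_side_subset (hV : IsOpen V) (a p : X) :
    V ∩ closure (side V a p) ⊆ insert p (side V a p) := by
  rintro z ⟨hzV, hz⟩
  by_cases hzp : z = p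
  · exact Or.inl hzp
  have hzV' : z ∈ V \ {p} := ⟨hzV, hzp⟩
  obtain ⟨y, hyz, hya⟩ := mem_closure_iff.1 hz _ (isOpen_side hV z p)
    (mem_connectedComponentIn hzV')
  right
  have he : side V a p = side V z p :=
    (connectedComponentIn_eq hya).trans (connectedComponentIn_eq hyz).symm
  rw [he]
  exact mem_connectedComponentIn hzV'

lemma mem_closure_side (hV : IsOpen V) (hVc : IsPreconnected V) (hp : p ∈ V) (ha : a ∈ V \ {p}) :
    p ∈ closure (side V a p) :=
  mem_closure_of_closure_subset_insert hVc hp (isOpen_side hV a p)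
    ⟨a, ha.1, mem_connectedComponentIn ha⟩ (not_mem_side V a p) (inter_closure_side_subset hV a p)

lemma isPreconnected_insert_side (hV : IsOpen V) (hVc : IsPreconnected V) (hp : p ∈ V)
    (ha : a ∈ V \ {p}) : IsPreconnected (insert p (side V a p)) :=
  isPreconnected_connectedComponentIn.subset_closure (subset_insert _ _)
    (insert_subset (mem_closure_side hV hVc hp ha) subset_closure)

lemma insert_side_subset_side (hV : IsOpen V) (hVc : IsPreconnected V) (hp : p ∈ V)
    (ha : a ∈ V \ {p}) (hqp : q ≠ p) (hq : q ∉ side V a p) :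
    insert p (side V a p) ⊆ side V a q := by
  refine (isPreconnected_insert_side hV hVc hp ha).subset_connectedComponentIn
    (Or.inr (mem_connectedComponentIn ha)) ?_
  rintro z (rfl | hz)
  · exact ⟨hp, fun h => hqp h.symm⟩
  · exact ⟨(connectedComponentIn_subset _ _ hz).1, fun h => hq (h ▸ hz)⟩

lemma mem_side_or_mem_side (hV : IsOpen V) (hVc : IsPreconnected V) (hp : p ∈ separators V a b)
    (hqp : q ≠ p) : q ∈ side V a p ∨ p ∈ side V a q := by
  by_cases hq : q ∈ side V a p
  · exact Or.inl hq
  · exact Or.inr (insert_side_subset_side hV hVc hp.1 hp.2.1 hqp hq (mem_insert _ _))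

/-- For two separators, `p` lies before `q` as seen from `a` if and only if `q` lies before `p` as
seen from `b`. -/
lemma mem_side_swap (hV : IsOpen V) (hVc : IsPreconnected V) (hq : q ∈ separators V a b)
    (h : p ∈ side V a q) : q ∈ side V b p := by
  have hpq : p ≠ q := fun he => not_mem_side V a q (he ▸ h)
  exact insert_side_subset_side hV hVc hq.1 hq.2.2.1 hpq
    (disjoint_left.1 (disjoint_side hq.2.2.2) h) (mem_insert _ _)

lemma not_mem_side_of_mem_side (hV : IsOpen V) (hVc : IsPreconnected V)
    (hp : p ∈ separators V a b) (hq : q ∈ separators V a b) (h : p ∈ side V a q) :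
    q ∉ side V a p :=
  disjoint_right.1 (disjoint_side hp.2.2.2) (mem_side_swap hV hVc hq h)

/-- Only countably many separators of `a` and `b` leave a third component. -/
lemma countable_separators_third [SecondCountableTopology X] (hV : IsOpen V)
    (hVc : IsPreconnected V) :
    {p ∈ separators V a b | ∃ c ∈ V \ {p}, c ∉ side V a p ∧ c ∉ side V b p}.Countable := by
  have hex : ∀ p : X, ∃ c : X, (∃ c ∈ V \ {p}, c ∉ side V a p ∧ c ∉ side V b p) →
      c ∈ V \ {p} ∧ c ∉ side V a p ∧ c ∉ side V b p := by
    intro p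
    by_cases h : ∃ c ∈ V \ {p}, c ∉ side V a p ∧ c ∉ side V b p
    · obtain ⟨c, hc⟩ := h
      exact ⟨c, fun _ => hc⟩
    · exact ⟨p, fun h' => absurd h' h⟩
  choose c hc using hex
  refine PairwiseDisjoint.countable_of_isOpen (s := fun p => side V (c p) p) ?_
    (fun p _ => isOpen_side hV _ p) (fun p hp => ⟨c p, mem_connectedComponentIn (hc p hp.2).1⟩)
  have key : ∀ p q : X, p ∈ separators V a b →
      (∃ c ∈ V \ {p}, c ∉ side V a p ∧ c ∉ side V b p) → q ∈ separators V a b →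
      (∃ c ∈ V \ {q}, c ∉ side V a q ∧ c ∉ side V b q) → p ∈ side V a q →
      Disjoint (side V (c p) p) (side V (c q) q) := by
    intro p q hp hp' hq hq' hpq
    obtain ⟨hc1, hc2, hc3⟩ := hc p hp'
    obtain ⟨hd1, hd2, hd3⟩ := hc q hq'
    have hqb := mem_side_swap hV hVc hq hpq
    have hqc : q ∉ side V (c p) p := disjoint_left.1 (disjoint_side hc3) hqb
    have hsub : insert p (side V (c p) p) ⊆ side V p q := by
      refine (isPreconnected_insert_side hV hVc hp.1 hc1).subset_connectedComponentIn
        (mem_insert _ _) ?_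
      rintro z (rfl | hz)
      · exact connectedComponentIn_subset _ _ hpq
      · exact ⟨(connectedComponentIn_subset _ _ hz).1, fun h => hqc (h ▸ hz)⟩
    have he : side V a q = side V p q := connectedComponentIn_eq hpq
    rw [← he] at hsub
    exact (disjoint_side hd2).mono_left ((subset_insert _ _).trans hsub)
  intro p hp q hq hpq
  rcases mem_side_or_mem_side hV hVc hp.1 hpq.symm with h | h
  · exact (key q p hq.1 hq.2 hp.1 hp.2 h).symm
  · exact key p q hp.1 hp.2 hq.1 hq.2 h

/-- All but countably many separators of `a` and `b` are limits of separators from the side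
of `a`. -/
lemma countable_separators_isolated [SecondCountableTopology X] (hV : IsOpen V)
    (hVc : IsPreconnected V) :
    {p ∈ separators V a b | p ∉ closure (separators V a b ∩ side V a p)}.Countable := by
  have hex : ∀ p : X, ∃ G : Set X, p ∉ closure (separators V a b ∩ side V a p) →
      G ∈ TopologicalSpace.countableBasis X ∧ p ∈ G ∧
        Disjoint G (separators V a b ∩ side V a p) := by
    intro p
    by_cases h : p ∈ closure (separators V a b ∩ side V a p)
    · exact ⟨∅, fun h' => absurd h h'⟩
    obtain ⟨G, hG, hpG, hGs⟩ :=
      (TopologicalSpace.isBasis_countableBasis X).exists_subset_of_mem_open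
        (show p ∈ (closure (separators V a b ∩ side V a p))ᶜ from h) isClosed_closure.isOpen_compl
    exact ⟨G, fun _ => ⟨hG, hpG, disjoint_left.2 fun z hz hz' => hGs hz (subset_closure hz')⟩⟩
  choose G hG using hex
  refine MapsTo.countable_of_injOn (f := G) (t := TopologicalSpace.countableBasis X)
    (fun p hp => (hG p hp.2).1) ?_ (TopologicalSpace.countable_countableBasis X)
  intro p hp q hq hpq
  by_contra hne
  rcases mem_side_or_mem_side hV hVc hp.1 (Ne.symm hne) with h | h
  · exact disjoint_left.1 (hG p hp.2).2.2 (hpq ▸ (hG q hq.2).2.1) ⟨hq.1, h⟩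
  · exact disjoint_left.1 (hG q hq.2).2.2 (hpq ▸ (hG p hp.2).2.1) ⟨hp.1, h⟩

/-- If the separator `p` is a limit of separators from the side of `a`, their sides of `a` exhaust
that of `p`. -/
lemma exists_separator_mem_side [T2Space X] (hV : IsOpen V) (hVc : IsPreconnected V)
    (hp : p ∈ separators V a b) (hcl : p ∈ closure (separators V a b ∩ side V a p)) {w : X}
    (hw : w ∈ side V a p) : ∃ r ∈ separators V a b ∩ side V a p, w ∈ side V a r := by
  set G : Set X := ⋃ r ∈ separators V a b ∩ side V a p, side V a r with hG
  suffices h : side V a p ⊆ G by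
    obtain ⟨r, hr, hwr⟩ := mem_iUnion₂.1 (h hw)
    exact ⟨r, hr, hwr⟩
  have hsne : (separators V a b ∩ side V a p).Nonempty := by
    rw [← closure_nonempty_iff]
    exact ⟨p, hcl⟩
  obtain ⟨r₁, hr₁⟩ := hsne
  refine isPreconnected_connectedComponentIn.subset_of_closure_inter_subset
    (isOpen_biUnion fun r _ => isOpen_side hV a r) ⟨a, mem_connectedComponentIn hp.2.1,
      mem_iUnion₂.2 ⟨r₁, hr₁, mem_connectedComponentIn hr₁.1.2.1⟩⟩ ?_
  rintro w ⟨hwG, hwp⟩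
  have hne : w ≠ p := fun h => not_mem_side V a p (h ▸ hwp)
  obtain ⟨O₁, O₂, hO₁, hO₂, hwO, hpO, hd⟩ := t2_separation hne
  have hwN : w ∈ O₁ ∩ V := ⟨hwO, (connectedComponentIn_subset _ _ hwp).1⟩
  obtain ⟨y, hyN, hyG⟩ := mem_closure_iff.1 hwG _ (hO₁.inter hV).connectedComponentIn
    (mem_connectedComponentIn hwN)
  obtain ⟨r₀, hr₀, hyr₀⟩ := mem_iUnion₂.1 hyG
  have hpr₀ : p ∉ closure (side V a r₀) := by
    intro h
    rcases inter_closure_side_subset hV a r₀ ⟨hp.1, h⟩ with h | h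
    · exact not_mem_side V a p (h ▸ hr₀.2)
    · exact not_mem_side_of_mem_side hV hVc hr₀.1 hp hr₀.2 h
  obtain ⟨r, ⟨hrO, hrr₀⟩, hr⟩ := mem_closure_iff.1 hcl _ (hO₂.inter isClosed_closure.isOpen_compl)
    ⟨hpO, hpr₀⟩
  have hrne : r ≠ r₀ := by
    rintro rfl
    exact hrr₀ (mem_closure_side hV hVc hr₀.1.1 hr₀.1.2.1)
  have hsub := insert_side_subset_side hV hVc hr₀.1.1 hr₀.1.2.1 hrne fun h =>
    hrr₀ (subset_closure h)
  have hyr : y ∈ side V a r := hsub (Or.inr hyr₀)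
  refine mem_iUnion₂.2 ⟨r, hr, ?_⟩
  have hNr : connectedComponentIn (O₁ ∩ V) w ⊆ side V y r := by
    refine isPreconnected_connectedComponentIn.subset_connectedComponentIn hyN fun z hz => ?_
    have := connectedComponentIn_subset _ _ hz
    exact ⟨this.2, fun h => disjoint_left.1 hd this.1 (h ▸ hrO)⟩
  have he : side V a r = side V y r := connectedComponentIn_eq hyr
  rw [he]
  exact hNr (mem_connectedComponentIn hwN)

end Separation

section LocalCutPoints

variable {X : Type*} [MetricSpace X] [CompactSpace X] [LocallyConnectedSpace X]

/-- Two points are separated in a connected open set by countably many points at most: any other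
separator would be a limit of separators from both sides and leave just two components, and the
sides of the separators close to it would make it a point of rim-countability. -/
lemma countable_separators (hX : NowhereRimCountable X) {V : Set X} (hV : IsOpen V)
    (hVc : IsPreconnected V) (a b : X) : (separators V a b).Countable := by
  refine ((countable_separators_third (a := a) (b := b) hV hVc).union
    ((countable_separators_isolated (a := a) (b := b) hV hVc).union
    (countable_separators_isolated (a := b) (b := a) hV hVc))).mono fun p hp => ?_
  by_contra hcon
  simp only [mem_union, mem_ofPred_eq, not_or, not_and, not_exists, not_not] at hcon
  obtain ⟨h1, h2, h3⟩ := hcon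
  refine hX p (isRimCountableAt_of_forall_exists_isOpen hV hp.1 fun w hw hwp => ?_)
  have key : ∀ a b : X, p ∈ separators V a b → p ∈ closure (separators V a b ∩ side V a p) →
      w ∈ side V a p → ∃ (B : Set X) (r : X), IsOpen B ∧ w ∈ B ∧ p ∉ B ∧ r ≠ p ∧
      V ∩ closure B ⊆ insert r B := by
    intro a b hp hcl hwa
    obtain ⟨r, hr, hwr⟩ := exists_separator_mem_side hV hVc hp hcl hwa
    exact ⟨side V a r, r, isOpen_side hV a r, hwr,
      not_mem_side_of_mem_side hV hVc hr.1 hp hr.2,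
      fun h => not_mem_side V a p (h ▸ hr.2), inter_closure_side_subset hV a r⟩
  by_cases hwa : w ∈ side V a p
  · exact key a b hp (h2 hp) hwa
  · have hwb : w ∈ side V b p := h1 hp w ⟨hw, hwp⟩ hwa
    exact key b a (mem_separators_comm hp) (h3 (mem_separators_comm hp)) hwb

lemma countable_isLocalCutPoint (hX : NowhereRimCountable X) :
    {x : X | IsLocalCutPoint x}.Countable := by
  obtain ⟨𝓑, h𝓑, h𝓑c, h𝓑b⟩ :=
    (TopologicalSpace.IsTopologicalBasis.isOpen_isPreconnected (α := X)).exists_countable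
  obtain ⟨D, hDc, hD⟩ := TopologicalSpace.exists_countable_dense X
  have hcount : (⋃ V ∈ 𝓑, ⋃ a ∈ D, ⋃ b ∈ D, separators V a b).Countable :=
    h𝓑c.biUnion fun V hV => hDc.biUnion fun a _ => hDc.biUnion fun b _ =>
      countable_separators hX (h𝓑 hV).1 (h𝓑 hV).2 a b
  refine hcount.mono ?_
  rintro p ⟨U, hU, hUc, hpU, hcut⟩
  obtain ⟨V, hV, hpV, hVU⟩ := h𝓑b.exists_subset_of_mem_open hpU hU
  simp only [IsPreconnected, not_forall] at hcut
  obtain ⟨u, v, hu, hv, huv, hnu, hnv, hemp⟩ := hcut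
  have hUp : IsOpen (U \ {p}) := hU.sdiff isClosed_singleton
  have hd : Disjoint (U \ {p} ∩ u) (U \ {p} ∩ v) :=
    disjoint_left.2 fun z hz hz' => hemp ⟨z, hz.1, hz.2, hz'.2⟩
  have hcov : U ⊆ insert p ((U \ {p} ∩ u) ∪ (U \ {p} ∩ v)) := by
    intro z hz
    by_cases hzp : z = p
    · exact Or.inl hzp
    · exact Or.inr ((huv ⟨hz, hzp⟩).imp (fun h => ⟨⟨hz, hzp⟩, h⟩) fun h => ⟨⟨hz, hzp⟩, h⟩)
  -- `p` is in the closure of both sides, so `V` and hence `V ∩ D` meets both of them.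
  have hmeet : ∀ A B : Set X, IsOpen A → IsOpen B → Disjoint A B → U ⊆ insert p (A ∪ B) →
      A ⊆ U \ {p} → A.Nonempty → ∃ a ∈ D, a ∈ V ∩ A := by
    rintro A B hA hB hd hcov hAU ⟨z, hz⟩
    have hp : p ∈ closure A := mem_closure_of_closure_subset_insert hUc.isPreconnected
      hpU hA ⟨z, (hAU hz).1, hz⟩ (fun h => (hAU h).2 rfl) (inter_closure_subset_insert hB hd hcov)
    obtain ⟨y, hy⟩ := mem_closure_iff.1 hp V (h𝓑 hV).1 hpV
    obtain ⟨a, ha, haD⟩ := hD.inter_open_nonempty _ ((h𝓑 hV).1.inter hA) ⟨y, hy⟩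
    exact ⟨a, haD, ha⟩
  obtain ⟨a, haD, haV, haA⟩ := hmeet _ _ (hUp.inter hu) (hUp.inter hv) hd hcov inter_subset_left hnu
  obtain ⟨b, hbD, hbV, hbB⟩ := hmeet _ _ (hUp.inter hv) (hUp.inter hu) hd.symm
    (by rwa [union_comm]) inter_subset_left hnv
  refine mem_iUnion₂.2 ⟨V, hV, mem_iUnion₂.2 ⟨a, haD, mem_iUnion₂.2 ⟨b, hbD, hpV, ⟨haV, haA.1.2⟩,
    ⟨hbV, hbB.1.2⟩, fun hba => ?_⟩⟩⟩
  have hsub : side V a p ⊆ (U \ {p} ∩ u) ∪ (U \ {p} ∩ v) := by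
    intro z hz
    have h1 := connectedComponentIn_subset _ _ hz
    exact (hcov (hVU h1.1)).resolve_left h1.2
  rcases isPreconnected_connectedComponentIn.subset_or_subset (hUp.inter hu) (hUp.inter hv) hd hsub
    with h | h
  · exact disjoint_left.1 hd (h hba) hbB
  · exact disjoint_left.1 hd haA (h (mem_connectedComponentIn ⟨haV, haA.1.2⟩))

end LocalCutPoints

/-! ### Cyclic elements -/

section Conjugate

variable {X : Type*} [TopologicalSpace X] {x y z w r : X} {E F : Set X}

lemma Separates.symm (h : Separates r x y) : Separates r y x := by
  obtain ⟨A, B, hA, hB, hd, hAB, hx, hy⟩ := h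
  exact ⟨B, A, hB, hA, hd.symm, by rw [union_comm, hAB], hy, hx⟩

lemma IsConjugate.symm (h : IsConjugate x y) : IsConjugate y x := fun r hr => h r hr.symm

lemma isConjugate_refl (x : X) : IsConjugate x x := by
  rintro r ⟨A, B, -, -, hd, -, hA, hB⟩
  exact disjoint_left.1 hd hA hB

lemma Separates.isCutPoint (h : Separates r x y) : IsCutPoint r := by
  obtain ⟨A, B, hA, hB, hd, hAB, hx, hy⟩ := h
  intro hpre
  rcases hpre.subset_or_subset hA hB hd hAB.ge with h | h
  · exact disjoint_left.1 hd (h (hAB ▸ Or.inr hy)) hy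
  · exact disjoint_left.1 hd hx (h (hAB ▸ Or.inl hx))

/-- A point that separates two points conjugate to `x` can only be `x` itself. -/
lemma Separates.eq_of_isConjugate (h : Separates r y z) (hy : IsConjugate x y)
    (hz : IsConjugate x z) : x = r := by
  obtain ⟨A, B, hA, hB, hd, hAB, hyA, hzB⟩ := h
  by_contra hne
  have hx : x ∈ A ∪ B := by rw [hAB]; exact hne
  rcases hx with hx | hx
  · exact hz r ⟨A, B, hA, hB, hd, hAB, hx, hzB⟩
  · exact hy r (Separates.symm ⟨A, B, hA, hB, hd, hAB, hyA, hx⟩)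

lemma IsConjugate.trans_of_ne (hxy : x ≠ y) (hxz : IsConjugate x z) (hxw : IsConjugate x w)
    (hyz : IsConjugate y z) (hyw : IsConjugate y w) : IsConjugate z w := fun _ hr =>
  hxy ((hr.eq_of_isConjugate hxz hxw).trans (hr.eq_of_isConjugate hyz hyw).symm)

/-- A nondegenerate cyclic element, described as the maximal set of pairwise conjugate points that
contains a given pair of distinct conjugate points. -/
def IsTrueCyclicElement (E : Set X) : Prop :=
  ∃ x y : X, x ≠ y ∧ IsConjugate x y ∧ E = {w | IsConjugate x w ∧ IsConjugate y w}

lemma IsTrueCyclicElement.isConjugate (hE : IsTrueCyclicElement E) (hz : z ∈ E) (hw : w ∈ E) :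
    IsConjugate z w := by
  obtain ⟨x, y, hne, hxy, rfl⟩ := hE
  exact IsConjugate.trans_of_ne hne hz.1 hw.1 hz.2 hw.2

lemma IsTrueCyclicElement.nontrivial (hE : IsTrueCyclicElement E) : E.Nontrivial := by
  obtain ⟨x, y, hne, hxy, rfl⟩ := hE
  exact ⟨x, ⟨isConjugate_refl x, hxy.symm⟩, y, ⟨hxy, isConjugate_refl y⟩, hne⟩

lemma IsTrueCyclicElement.eq_setOf (hE : IsTrueCyclicElement E) (hz : z ∈ E) (hw : w ∈ E)
    (hzw : z ≠ w) : E = {v | IsConjugate z v ∧ IsConjugate w v} := by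
  refine Subset.antisymm (fun v hv => ⟨hE.isConjugate hz hv, hE.isConjugate hw hv⟩) fun v hv => ?_
  obtain ⟨x, y, hne, hxy, rfl⟩ := hE
  exact ⟨IsConjugate.trans_of_ne hzw hz.1.symm hv.1 hw.1.symm hv.2,
    IsConjugate.trans_of_ne hzw hz.2.symm hv.1 hw.2.symm hv.2⟩

lemma IsTrueCyclicElement.eq_of_mem (hE : IsTrueCyclicElement E) (hF : IsTrueCyclicElement F)
    (hz : z ∈ E) (hw : w ∈ E) (hz' : z ∈ F) (hw' : w ∈ F) (hzw : z ≠ w) : E = F := by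
  rw [hE.eq_setOf hz hw hzw, hF.eq_setOf hz' hw' hzw]

lemma IsTrueCyclicElement.mem_of_forall (hE : IsTrueCyclicElement E)
    (h : ∀ v ∈ E, IsConjugate v z) : z ∈ E := by
  obtain ⟨x, y, hne, hxy, rfl⟩ := hE
  exact ⟨h x ⟨isConjugate_refl x, hxy.symm⟩, h y ⟨hxy, isConjugate_refl y⟩⟩

lemma IsTrueCyclicElement.exists_not_isConjugate (hE : IsTrueCyclicElement E)
    (hF : IsTrueCyclicElement F) (hne : E ≠ F) : ∃ z ∈ E, ∃ w ∈ F, ¬ IsConjugate z w := by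
  by_contra hcon
  push Not at hcon
  have hFE : F ⊆ E := fun w hw => hE.mem_of_forall fun v hv => hcon v hv w hw
  obtain ⟨z, hz, w, hw, hzw⟩ := hF.nontrivial
  exact hne (hE.eq_of_mem hF (hFE hz) (hFE hw) hz hw hzw)

/-- A separation by `r` leaves a set of pairwise conjugate points on one side. -/
lemma IsTrueCyclicElement.subset_insert_of_separation (hE : IsTrueCyclicElement E)
    {A B : Set X} (hA : IsOpen A) (hB : IsOpen B) (hd : Disjoint A B) (hAB : A ∪ B = {r}ᶜ)
    (hzA : z ∈ A) (hz : z ∈ E) :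
    E ⊆ insert r A := by
  intro w hw
  by_cases hwr : w = r
  · exact Or.inl hwr
  have : w ∈ A ∪ B := by rw [hAB]; exact hwr
  rcases this with h | h
  · exact Or.inr h
  · exact absurd ⟨A, B, hA, hB, hd, hAB, hzA, h⟩ (hE.isConjugate hz hw r)

lemma isClosed_setOf_isConjugate (x : X) : IsClosed {w | IsConjugate x w} := by
  rw [← isOpen_compl_iff, isOpen_iff_mem_nhds]
  intro w hw
  simp only [mem_compl_iff, mem_ofPred_eq, IsConjugate, not_forall, not_not] at hw
  obtain ⟨r, A, B, hA, hB, hd, hAB, hx, hwB⟩ := hw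
  filter_upwards [hB.mem_nhds hwB] with v hv hxv
  exact hxv r ⟨A, B, hA, hB, hd, hAB, hx, hv⟩

lemma IsTrueCyclicElement.isClosed (hE : IsTrueCyclicElement E) : IsClosed E := by
  obtain ⟨x, y, hne, hxy, rfl⟩ := hE
  exact (isClosed_setOf_isConjugate x).inter (isClosed_setOf_isConjugate y)

lemma Separates.map (f : X ≃ₜ X) (h : Separates r x y) : Separates (f r) (f x) (f y) := by
  obtain ⟨A, B, hA, hB, hd, hAB, hx, hy⟩ := h
  refine ⟨f '' A, f '' B, f.isOpen_image.2 hA, f.isOpen_image.2 hB,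
    (disjoint_image_iff f.injective).2 hd, ?_, mem_image_of_mem _ hx, mem_image_of_mem _ hy⟩
  rw [← image_union, hAB, image_compl_eq f.bijective, image_singleton]

lemma isConjugate_map_iff (f : X ≃ₜ X) : IsConjugate (f x) (f y) ↔ IsConjugate x y := by
  refine ⟨fun h r hr => h _ (hr.map f), fun h r hr => h (f.symm r) ?_⟩
  simpa using hr.map f.symm

lemma IsTrueCyclicElement.image (f : X ≃ₜ X) (hE : IsTrueCyclicElement E) :
    IsTrueCyclicElement (f '' E) := by
  obtain ⟨x, y, hne, hxy, rfl⟩ := hE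
  refine ⟨f x, f y, f.injective.ne hne, (isConjugate_map_iff f).2 hxy, ?_⟩
  ext w
  obtain ⟨v, rfl⟩ := f.surjective w
  rw [f.injective.mem_set_image]
  simp only [mem_ofPred_eq, isConjugate_map_iff]

/-- A nondegenerate cyclic element is connected: cutting away from `X`, at finitely many points, the
far sides of separations leaves a connected set, and by compactness such a set can be squeezed into
any given neighbourhood of the cyclic element. -/
lemma IsTrueCyclicElement.isPreconnected [T2Space X] [CompactSpace X] [PreconnectedSpace X]
    (hE : IsTrueCyclicElement E) : IsPreconnected E := by
  rw [isPreconnected_iff_subset_of_fully_disjoint_closed hE.isClosed]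
  intro u v hu hv huv hd
  obtain ⟨Ou, Ov, hOu, hOv, huO, hvO, hO⟩ := normal_separation hu hv hd
  have hsep : ∀ z : X, ∃ (r : X) (A B : Set X), z ∈ (Ou ∪ Ov)ᶜ →
      IsOpen A ∧ IsOpen B ∧ Disjoint A B ∧ A ∪ B = {r}ᶜ ∧ E ⊆ insert r A ∧ z ∈ B := by
    intro z
    by_cases hz : z ∈ (Ou ∪ Ov)ᶜ
    swap
    · exact ⟨z, ∅, ∅, fun h => absurd h hz⟩
    have hzE : z ∉ E := fun h => hz ((huv h).imp (@huO z) (@hvO z))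
    obtain ⟨w, hw, hwz⟩ : ∃ w ∈ E, ¬ IsConjugate w z := by
      by_contra hcon
      push Not at hcon
      exact hzE (hE.mem_of_forall hcon)
    simp only [IsConjugate, not_forall, not_not] at hwz
    obtain ⟨r, A, B, hA, hB, hd, hAB, hwA, hzB⟩ := hwz
    exact ⟨r, A, B, fun _ => ⟨hA, hB, hd, hAB,
      hE.subset_insert_of_separation hA hB hd hAB hwA hw, hzB⟩⟩
  choose r A B h using hsep
  obtain ⟨t, htM, htf, ht⟩ := (hOu.union hOv).isClosed_compl.isCompact.elim_finite_subcover_image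
    (b := (Ou ∪ Ov)ᶜ) (c := B) (fun z hz => (h z hz).2.1)
    (fun z hz => mem_iUnion₂.2 ⟨z, hz, (h z hz).2.2.2.2.2⟩)
  have hconn : IsPreconnected (⋂ z ∈ t, insert (r z) (A z)) ∧
      E ⊆ ⋂ z ∈ t, insert (r z) (A z) := by
    clear ht
    induction t, htf using Set.Finite.induction_on with
    | empty => simpa using isPreconnected_univ
    | @insert z s hzs hs ih =>
      obtain ⟨ih1, ih2⟩ := ih ((subset_insert _ _).trans htM)
      obtain ⟨hA, hB, hd, hAB, hEA, -⟩ := h z (htM (mem_insert _ _))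
      rw [biInter_insert, inter_comm]
      refine ⟨?_, subset_inter ih2 hEA⟩
      have hcov : (univ : Set X) ⊆ insert (r z) (A z ∪ B z) := by
        intro y _
        rw [hAB]
        exact em _
      by_cases hr : r z ∈ ⋂ z ∈ s, insert (r z) (A z)
      · exact isPreconnected_inter_insert ih1 hr hA hB hd ((subset_univ _).trans hcov)
      · have hsub : ⋂ z ∈ s, insert (r z) (A z) ⊆ A z ∪ B z := fun y hy =>
          (hcov (mem_univ y)).resolve_left fun he => hr (he ▸ hy)
        have hside : ⋂ z ∈ s, insert (r z) (A z) ⊆ A z := by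
          obtain ⟨w, hw, hwr⟩ := hE.nontrivial.exists_ne (r z)
          have hwA : w ∈ A z := (hEA hw).resolve_left hwr
          refine (ih1.subset_or_subset hA hB hd hsub).resolve_right fun hsB => ?_
          exact disjoint_left.1 hd hwA (hsB (ih2 hw))
        rwa [inter_eq_left.2 (hside.trans (subset_insert _ _))]
  have hsub : ⋂ z ∈ t, insert (r z) (A z) ⊆ Ou ∪ Ov := by
    intro y hy
    by_contra hcon
    obtain ⟨z, hz, hyz⟩ := mem_iUnion₂.1 (ht hcon)
    obtain ⟨-, -, hd, hAB, -, -⟩ := h z (htM hz)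
    rcases mem_iInter₂.1 hy z hz with rfl | hyA
    · have : r z ∈ A z ∪ B z := Or.inr hyz
      rw [hAB] at this
      exact this rfl
    · exact disjoint_left.1 hd hyA hyz
  rcases hconn.1.subset_or_subset hOu hOv hO hsub with h' | h'
  · exact Or.inl fun y hy => (huv hy).resolve_right fun hyv =>
      disjoint_left.1 hO (h' (hconn.2 hy)) (hvO hyv)
  · exact Or.inr fun y hy => (huv hy).resolve_left fun hyu =>
      disjoint_left.1 hO (huO hyu) (h' (hconn.2 hy))

lemma sUnion_isCyclicElement : ⋃₀ {E : Set X | IsCyclicElement E} = univ := by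
  refine eq_univ_of_forall fun p => ?_
  by_cases hp : IsCutPoint p ∨ IsEndPoint p
  · exact ⟨{p}, ⟨p, Or.inl ⟨hp, rfl⟩⟩, rfl⟩
  · push Not at hp
    exact ⟨_, ⟨p, Or.inr ⟨hp.1, hp.2, rfl⟩⟩, isConjugate_refl p⟩

end Conjugate

section CyclicElements

variable {X : Type*} [MetricSpace X] [CompactSpace X]

/-- A point that is conjugate to no other point has small neighbourhoods with finite boundary. -/
lemma NowhereRimCountable.exists_isConjugate (hX : NowhereRimCountable X) (p : X) :
    ∃ z, p ≠ z ∧ IsConjugate p z := by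
  by_contra hcon
  push Not at hcon
  refine hX p (isRimCountableAt_of_forall_exists_isOpen isOpen_univ (mem_univ p) fun w _ hw => ?_)
  have := hcon w hw.symm
  simp only [IsConjugate, not_forall, not_not] at this
  obtain ⟨r, A, B, hA, hB, hd, hAB, hpA, hwB⟩ := this
  refine ⟨B, r, hB, hwB, disjoint_left.1 hd hpA, ?_, ?_⟩
  · rintro rfl
    have : r ∈ A ∪ B := Or.inl hpA
    rw [hAB] at this
    exact this rfl
  · refine inter_closure_subset_insert hA hd.symm ?_
    intro z _
    rw [union_comm, hAB]
    exact em _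

lemma NowhereRimCountable.exists_isTrueCyclicElement (hX : NowhereRimCountable X) (p : X) :
    ∃ E : Set X, IsTrueCyclicElement E ∧ p ∈ E := by
  obtain ⟨z, hne, hz⟩ := hX.exists_isConjugate p
  exact ⟨_, ⟨p, z, hne, hz, rfl⟩, isConjugate_refl p, hz.symm⟩

/-- The nondegenerate cyclic elements form a null family. Two of them that contain nearby points at
two distant places would be separated by a single point, which would have to lie on small connected
sets at both places. -/
lemma finite_isTrueCyclicElement_large [LocallyConnectedSpace X] {ε : ℝ} (hε : 0 < ε) :
    {E : Set X | IsTrueCyclicElement E ∧ ∃ u ∈ E, ∃ v ∈ E, ε ≤ dist u v}.Finite := by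
  by_contra hinf
  have hex : ∀ E : Set X, ∃ p : X × X, (IsTrueCyclicElement E ∧ ∃ u ∈ E, ∃ v ∈ E, ε ≤ dist u v) →
      p.1 ∈ E ∧ p.2 ∈ E ∧ ε ≤ dist p.1 p.2 := by
    intro E
    by_cases h : IsTrueCyclicElement E ∧ ∃ u ∈ E, ∃ v ∈ E, ε ≤ dist u v
    · obtain ⟨-, u, hu, v, hv, hd⟩ := h
      exact ⟨(u, v), fun _ => ⟨hu, hv, hd⟩⟩
    · obtain ⟨E, hE, -⟩ := Set.Infinite.nonempty hinf
      obtain ⟨x, -⟩ := hE.nontrivial.nonempty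
      exact ⟨(x, x), fun h' => absurd h' h⟩
  choose g hg using hex
  obtain ⟨δ, hδ, hulc⟩ := exists_uniform_small_continuum (X := X) (ε := ε / 3) (by positivity)
  obtain ⟨t, htf, ht⟩ := Metric.totallyBounded_iff.1
    (isCompact_univ (X := X × X)).totallyBounded (δ / 2) (half_pos hδ)
  have hcov : ∀ q : X × X, ∃ c ∈ t, dist q c < δ / 2 := by
    intro q
    obtain ⟨c, hc, hq⟩ := mem_iUnion₂.1 (ht (mem_univ q))
    exact ⟨c, hc, hq⟩
  choose k hkt hkd using hcov
  obtain ⟨E, hE, F, hF, hEF, hk⟩ := Set.Infinite.exists_ne_map_eq_of_mapsTo hinf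
    (f := fun E => k (g E)) (t := t) (fun E _ => hkt _) htf
  have hd : dist (g E) (g F) < δ := by
    have h1 := hkd (g E)
    have h2 := hkd (g F)
    rw [← hk, dist_comm] at h2
    linarith [dist_triangle (g E) (k (g E)) (g F)]
  obtain ⟨hgE1, hgE2, hgE⟩ := hg E hE
  obtain ⟨hgF1, hgF2, -⟩ := hg F hF
  rw [Prod.dist_eq, max_lt_iff] at hd
  obtain ⟨T₁, hT₁, hE1, hF1, hs1⟩ := hulc _ _ hd.1
  obtain ⟨T₂, hT₂, hE2, hF2, hs2⟩ := hulc _ _ hd.2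
  obtain ⟨z, hz, w, hw, hzw⟩ := hE.1.exists_not_isConjugate hF.1 hEF
  simp only [IsConjugate, not_forall, not_not] at hzw
  obtain ⟨r, A, B, hA, hB, hAB, hABr, hzA, hwB⟩ := hzw
  have hEA := hE.1.subset_insert_of_separation hA hB hAB hABr hzA hz
  have hFB := hF.1.subset_insert_of_separation hB hA hAB.symm (by rw [union_comm, hABr]) hwB hw
  have key : ∀ T : Set X, IsContinuum T → ∀ p ∈ T, ∀ q ∈ T, p ∈ E → q ∈ F → r ∈ T := by
    intro T hT p hp q hq hpE hqF
    by_contra hr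
    have hTs : T ⊆ A ∪ B := by
      rw [hABr]
      exact fun z hz h => hr (h ▸ hz)
    have hpA : p ∈ A := (hEA hpE).resolve_left fun h => hr (h ▸ hp)
    have hqB : q ∈ B := (hFB hqF).resolve_left fun h => hr (h ▸ hq)
    rcases hT.2.isPreconnected.subset_or_subset hA hB hAB hTs with h | h
    · exact disjoint_left.1 hAB (h hq) hqB
    · exact disjoint_left.1 hAB hpA (h hp)
  have hr1 := hs1 _ hE1 _ (key T₁ hT₁ _ hE1 _ hF1 hgE1 hgF1)
  have hr2 := hs2 _ (key T₂ hT₂ _ hE2 _ hF2 hgE2 hgF2) _ hE2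
  linarith [dist_triangle (g E).1 r (g E).2]

variable [ConnectedSpace X]

lemma IsTrueCyclicElement.isContinuum {E : Set X} (hE : IsTrueCyclicElement E) : IsContinuum E :=
  ⟨hE.isClosed.isCompact, hE.nontrivial.nonempty, hE.isPreconnected⟩

/-- If there are only finitely many nondegenerate cyclic elements, each cut point lies in two of
them, one on either side, and two of them have at most one common point. -/
lemma finite_isCutPoint (hX : NowhereRimCountable X)
    (hfin : {E : Set X | IsTrueCyclicElement E}.Finite) : {p : X | IsCutPoint p}.Finite := by
  refine (hfin.biUnion fun E hE => hfin.biUnion fun F hF =>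
    (show (if E = F then ∅ else E ∩ F).Finite from ?_)).subset
    (s := ⋃ E ∈ {E : Set X | IsTrueCyclicElement E}, ⋃ F ∈ {E : Set X | IsTrueCyclicElement E},
      (if E = F then ∅ else E ∩ F)) ?_
  · split_ifs with hEF
    · exact finite_empty
    · refine Set.Subsingleton.finite fun z hz w hw => ?_
      by_contra hzw
      exact hEF (IsTrueCyclicElement.eq_of_mem hE hF hz.1 hw.1 hz.2 hw.2 hzw)
  intro p hp
  have hp' : ¬ IsPreconnected ({p}ᶜ : Set X) := hp
  simp only [IsPreconnected, not_forall] at hp'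
  obtain ⟨u, v, hu, hv, huv, hnu, hnv, hemp⟩ := hp'
  have hpo : IsOpen ({p}ᶜ : Set X) := isOpen_compl_singleton
  have hd : Disjoint ({p}ᶜ ∩ u) ({p}ᶜ ∩ v) :=
    disjoint_left.2 fun z hz hz' => hemp ⟨z, hz.1, hz.2, hz'.2⟩
  have hAB : ({p}ᶜ ∩ u) ∪ ({p}ᶜ ∩ v) = {p}ᶜ := by
    rw [← inter_union_distrib_left, inter_eq_left.2 huv]
  have key : ∀ A B : Set X, IsOpen A → IsOpen B → Disjoint A B → A ∪ B = {p}ᶜ → A.Nonempty →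
      ∃ E, IsTrueCyclicElement E ∧ p ∈ E ∧ ∃ z ∈ A, z ∈ E := by
    intro A B hA hB hd hAB hne
    have hpA : p ∉ A := fun h => by
      have : p ∈ A ∪ B := Or.inl h
      rw [hAB] at this
      exact this rfl
    have hcov : (univ : Set X) ⊆ insert p (A ∪ B) := by
      intro z _
      rw [hAB]
      exact em _
    have hcl : p ∈ closure A := mem_closure_of_closure_subset_insert
      isPreconnected_univ (mem_univ p) hA (by rwa [univ_inter]) hpA
      (inter_closure_subset_insert hB hd hcov)
    have hfin' : {E : Set X | IsTrueCyclicElement E ∧ ∃ z ∈ A, z ∈ E}.Finite :=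
      hfin.subset fun E hE => hE.1
    have hclosed : IsClosed (⋃ E ∈ {E : Set X | IsTrueCyclicElement E ∧ ∃ z ∈ A, z ∈ E}, E) :=
      hfin'.isClosed_biUnion fun E hE => hE.1.isClosed
    have hsub : A ⊆ ⋃ E ∈ {E : Set X | IsTrueCyclicElement E ∧ ∃ z ∈ A, z ∈ E}, E := by
      intro z hz
      obtain ⟨E, hE, hzE⟩ := hX.exists_isTrueCyclicElement z
      exact mem_iUnion₂.2 ⟨E, ⟨hE, z, hz, hzE⟩, hzE⟩
    obtain ⟨E, hE, hpE⟩ := mem_iUnion₂.1 (closure_minimal hsub hclosed hcl)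
    exact ⟨E, hE.1, hpE, hE.2⟩
  obtain ⟨E, hE, hpE, z, hzA, hzE⟩ := key _ _ (hpo.inter hu) (hpo.inter hv) hd hAB hnu
  obtain ⟨F, hF, hpF, w, hwB, hwF⟩ := key _ _ (hpo.inter hv) (hpo.inter hu) hd.symm
    (by rw [union_comm, hAB]) hnv
  refine mem_iUnion₂.2 ⟨E, hE, mem_iUnion₂.2 ⟨F, hF, ?_⟩⟩
  rw [if_neg]
  · exact ⟨hpE, hpF⟩
  · rintro rfl
    exact hE.isConjugate hzE hwF p ⟨_, _, hpo.inter hu, hpo.inter hv, hd, hAB, hzA, hwB⟩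

lemma finite_isCyclicElement (hX : NowhereRimCountable X) (hend : ∀ p : X, ¬ IsEndPoint p)
    (hfin : {E : Set X | IsTrueCyclicElement E}.Finite) :
    {E : Set X | IsCyclicElement E}.Finite := by
  refine (((finite_isCutPoint hX hfin).image fun p => ({p} : Set X)).union hfin).subset ?_
  rintro E ⟨p, ⟨hp | hp, rfl⟩ | ⟨hp, -, rfl⟩⟩
  · exact Or.inl ⟨p, hp, rfl⟩
  · exact absurd hp (hend p)
  · obtain ⟨z, hne, hz⟩ := hX.exists_isConjugate p
    refine Or.inr ⟨p, z, hne, hz, ?_⟩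
    refine Subset.antisymm (fun x hx => ⟨hx, fun r hr => hp ?_⟩) fun x hx => hx.1
    exact hr.eq_of_isConjugate hz hx ▸ hr.isCutPoint

variable [LocallyConnectedSpace X] {f : X ≃ₜ X} {α : ℝ}

/-- The orbit of a nondegenerate cyclic element is finite: otherwise its members would be small in
the far past and in the far future, hence always. -/
lemma IsCWConstant.finite_orbit (h : IsCWConstant f α) {E : Set X} (hE : IsTrueCyclicElement E)
    (hEα : ¬ SmallAt f E α 0) : (range fun n : ℤ => (f ^ n) '' E).Finite := by
  obtain ⟨δ, hδ, hbet⟩ := h.exists_smallAt_between h.1 le_rfl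
  have hZ : {n : ℤ | ¬ SmallAt f E δ n}.Infinite := by
    intro hfin
    obtain ⟨a, ha⟩ := hfin.bddBelow
    obtain ⟨b, hb⟩ := hfin.bddAbove
    have h1 : SmallAt f E δ (min a 0 - 1) := by
      by_contra hcon
      have := ha hcon
      have := min_le_left a 0
      omega
    have h2 : SmallAt f E δ (max b 0 + 1) := by
      by_contra hcon
      have := hb hcon
      have := le_max_left b 0
      omega
    exact hEα (hbet E hE.isContinuum _ _ h1 h2 0 (by omega) (by omega))
  obtain ⟨m, hm, n, hn, hmn, he⟩ := hZ.exists_ne_map_eq_of_mapsTo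
    (f := fun n : ℤ => (f ^ n) '' E) (fun n hn => by
      refine ⟨hE.image (f ^ n), ?_⟩
      by_contra hcon
      push Not at hcon
      refine hn ?_
      rw [← zero_add n, ← smallAt_image_iff, smallAt_zero_iff]
      exact fun u hu v hv => (hcon u hu v hv).le) (finite_isTrueCyclicElement_large (X := X) hδ)
  obtain ⟨k, hk, hkE⟩ : ∃ k : ℤ, 0 < k ∧ (f ^ k) '' E = E := by
    have key : ∀ m n : ℤ, m < n → (f ^ m) '' E = (f ^ n) '' E →
        ∃ k : ℤ, 0 < k ∧ (f ^ k) '' E = E := by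
      intro m n hmn he
      refine ⟨n - m, sub_pos.2 hmn, ?_⟩
      rw [show n - m = -m + n by ring, ← zpow_image_zpow_image, ← he, zpow_image_zpow_image,
        neg_add_cancel, zpow_zero]
      exact image_id E
    rcases lt_or_gt_of_ne hmn with h' | h'
    · exact key m n h' he
    · exact key n m h' he.symm
  have hper : ∀ (j : ℤ), (f ^ (k * j)) '' E = E := by
    have hnat : ∀ j : ℕ, (f ^ (k * (j : ℤ))) '' E = E := by
      intro j
      induction j with
      | zero => rw [Nat.cast_zero, mul_zero, zpow_zero]; exact image_id E
      | succ j ih =>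
        rw [Nat.cast_succ, mul_add, mul_one, ← zpow_image_zpow_image, hkE, ih]
    intro j
    obtain ⟨i, rfl | rfl⟩ := j.eq_nat_or_neg
    · exact hnat i
    · conv_lhs => rw [← hnat i]
      rw [zpow_image_zpow_image, mul_neg, neg_add_cancel, zpow_zero]
      exact image_id E
  refine ((Set.finite_Ico 0 k).image fun n : ℤ => (f ^ n) '' E).subset ?_
  rintro _ ⟨n, rfl⟩
  refine ⟨n % k, ⟨Int.emod_nonneg n hk.ne', Int.emod_lt_of_pos n hk⟩, ?_⟩
  show (f ^ (n % k)) '' E = (f ^ n) '' E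
  conv_rhs => rw [← Int.emod_add_mul_ediv n k, ← zpow_image_zpow_image, hper]

/-- Every nondegenerate cyclic element has an iterate among the finitely many large ones, and those
have finite orbits. -/
lemma IsCWConstant.finite_isTrueCyclicElement (h : IsCWConstant f α) :
    {E : Set X | IsTrueCyclicElement E}.Finite := by
  have hlarge : {E : Set X | IsTrueCyclicElement E ∧ ¬ SmallAt f E α 0}.Finite := by
    refine (finite_isTrueCyclicElement_large (X := X) h.1).subset ?_
    rintro E ⟨hE, hs⟩
    refine ⟨hE, ?_⟩
    by_contra hcon
    push Not at hcon
    exact hs (smallAt_zero_iff.2 fun u hu v hv => (hcon u hu v hv).le)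
  refine (hlarge.biUnion fun E hE => h.finite_orbit hE.1 hE.2).subset fun E hE => ?_
  obtain ⟨n, hn⟩ := h.2 E hE.isContinuum hE.nontrivial
  refine mem_iUnion₂.2 ⟨(f ^ n) '' E, ⟨hE.image _, ?_⟩, -n, ?_⟩
  · rwa [smallAt_image_iff, zero_add]
  · show (f ^ (-n)) '' ((f ^ n) '' E) = E
    rw [zpow_image_zpow_image, neg_add_cancel, zpow_zero]
    exact image_id E

end CyclicElements

/-! ### Local path connectedness -/

section Paths

variable {X : Type*} [MetricSpace X]

/-- `x` and `y` lie in a connected set of diameter at most `ε`. -/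
def IsClose (ε : ℝ) (x y : X) : Prop :=
  ∃ T : Set X, IsPreconnected T ∧ x ∈ T ∧ y ∈ T ∧ ∀ a ∈ T, ∀ b ∈ T, dist a b ≤ ε

lemma IsClose.dist_le {ε : ℝ} {x y : X} (h : IsClose ε x y) : dist x y ≤ ε := by
  obtain ⟨T, -, hx, hy, hT⟩ := h
  exact hT x hx y hy

lemma IsClose.refl {ε : ℝ} (hε : 0 ≤ ε) (x : X) : IsClose ε x x :=
  ⟨{x}, isPreconnected_singleton, rfl, rfl, by
    rintro a rfl b rfl
    rwa [dist_self]⟩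

variable [CompactSpace X] [LocallyConnectedSpace X]

/-- `ε`-close points are joined by a finite chain of consecutively `η`-close points, written as an
eventually constant sequence. -/
lemma IsClose.exists_chain {ε η : ℝ} (hη : 0 < η) {x y : X} (h : IsClose ε x y) :
    ∃ (c : ℕ → X) (n : ℕ), c 0 = x ∧ (∀ j, n ≤ j → c j = y) ∧
      (∀ j, IsClose η (c j) (c (j + 1))) ∧ ∀ j, dist x (c j) ≤ ε := by
  obtain ⟨T, hT, hx, hy, hTε⟩ := h
  obtain ⟨δ, hδ, hulc⟩ := exists_uniform_small_continuum (X := X) hη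
  have hclose : ∀ a b : X, dist a b < δ → IsClose η a b := by
    intro a b hab
    obtain ⟨T, hT, h⟩ := hulc a b hab
    exact ⟨T, hT.2.isPreconnected, h⟩
  suffices H : ∃ (c : ℕ → X) (n : ℕ), c 0 = x ∧ (∀ j, n ≤ j → c j = y) ∧
      (∀ j, IsClose η (c j) (c (j + 1))) ∧ ∀ j, c j ∈ T by
    obtain ⟨c, n, h0, h1, h2, h3⟩ := H
    exact ⟨c, n, h0, h1, h2, fun j => hTε x hx _ (h3 j)⟩
  refine hT.induction₂' (fun x y => ∃ (c : ℕ → X) (n : ℕ), c 0 = x ∧ (∀ j, n ≤ j → c j = y) ∧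
      (∀ j, IsClose η (c j) (c (j + 1))) ∧ ∀ j, c j ∈ T) ?_ ?_ hx hy
  · intro a ha
    have hstep : ∀ a ∈ T, ∀ b ∈ T, dist a b < δ → ∃ (c : ℕ → X) (n : ℕ), c 0 = a ∧
        (∀ j, n ≤ j → c j = b) ∧ (∀ j, IsClose η (c j) (c (j + 1))) ∧ ∀ j, c j ∈ T := by
      intro a ha b hb hab
      refine ⟨fun j => if j = 0 then a else b, 1, if_pos rfl, fun j hj => if_neg (by omega), ?_, ?_⟩
      · intro j
        simp only [Nat.add_eq_zero_iff, one_ne_zero, and_false, if_false]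
        split_ifs
        · exact hclose a b hab
        · exact IsClose.refl hη.le b
      · intro j
        dsimp only
        split_ifs <;> assumption
    filter_upwards [mem_nhdsWithin_of_mem_nhds (Metric.ball_mem_nhds a hδ), self_mem_nhdsWithin]
      with b hb hbT
    exact ⟨hstep a ha b hbT (by rw [dist_comm]; exact hb), hstep b hbT a ha hb⟩
  · rintro a b d - - - ⟨c, n, h0, h1, h2, h3⟩ ⟨c', n', h0', h1', h2', h3'⟩
    refine ⟨fun j => if j < n then c j else c' (j - n), n + n', ?_, ?_, ?_, ?_⟩
    · dsimp only
      split_ifs with hn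
      · exact h0
      · rw [Nat.zero_sub, h0', ← h0, h1 0 (by omega)]
    · intro j hj
      dsimp only
      rw [if_neg (by omega)]
      exact h1' _ (by omega)
    · intro j
      dsimp only
      rcases lt_trichotomy (j + 1) n with hj | hj | hj
      · rw [if_pos hj, if_pos (by omega)]
        exact h2 j
      · rw [if_pos (by omega), if_neg (by omega), hj, Nat.sub_self, h0', ← h1 n le_rfl, ← hj]
        exact h2 j
      · rw [if_neg (by omega), if_neg (by omega), Nat.sub_add_comm (by omega)]
        exact h2' _
    · intro j
      dsimp only
      split_ifs
      · exact h3 j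
      · exact h3' _

/-- A chain of `ε`-close points is refined to a chain of `η`-close points by subdividing all its
links into the same number of links. -/
lemma exists_refined_chain {ε η : ℝ} (hε : 0 ≤ ε) (hη : 0 < η) {y : X} {N : ℕ} {c : ℕ → X}
    (hN : 0 < N) (hc : ∀ j, IsClose ε (c j) (c (j + 1))) (hy : ∀ j, N ≤ j → c j = y) :
    ∃ (m : ℕ) (c' : ℕ → X), 0 < m ∧ c' 0 = c 0 ∧ (∀ j, IsClose η (c' j) (c' (j + 1))) ∧
      (∀ j, N * m ≤ j → c' j = y) ∧ ∀ j, dist (c (j / m)) (c' j) ≤ ε := by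
  choose d n hd0 hdn hdc hdd using fun i => (hc i).exists_chain hη
  obtain ⟨m, hm0, hmn⟩ : ∃ m, 0 < m ∧ ∀ i < N, n i ≤ m :=
    ⟨(Finset.range N).sup n + 1, Nat.succ_pos _, fun i hi =>
      (Finset.le_sup (Finset.mem_range.2 hi)).trans (Nat.le_succ _)⟩
  refine ⟨m, fun j => if j / m < N then d (j / m) (j % m) else y, hm0, ?_, ?_, ?_, ?_⟩
  · simp only [Nat.zero_div, Nat.zero_mod, if_pos hN, hd0]
  · intro j
    dsimp only
    have hlt := Nat.mod_lt j hm0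
    have hj := Nat.div_add_mod j m
    by_cases hjm : j % m + 1 < m
    · have h1 : (j + 1) / m = j / m := by
        rw [Nat.div_eq_iff hm0]
        constructor
        · rw [mul_comm]; omega
        · rw [mul_comm]; omega
      have h2 : (j + 1) % m = j % m + 1 := by
        rw [Nat.add_mod_eq_add_mod_right 1 (Nat.mod_mod j m).symm, Nat.mod_eq_of_lt hjm]
      rw [h1, h2]
      split_ifs
      · exact hdc _ _
      · exact IsClose.refl hη.le y
    · have hjm' : j % m + 1 = m := by omega
      have h0 : j + 1 = m * (j / m + 1) := by rw [mul_add, mul_one]; omega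
      have h1 : (j + 1) / m = j / m + 1 := by rw [h0, Nat.mul_div_cancel_left _ hm0]
      have h2 : (j + 1) % m = 0 := by rw [h0, Nat.mul_mod_right]
      rw [h1, h2]
      by_cases hjN : j / m < N
      · have he : d (j / m) (j % m + 1) = c (j / m + 1) := by
          rw [hjm']; exact hdn _ _ (hmn _ hjN)
        have hcl := hdc (j / m) (j % m)
        rw [he] at hcl
        rw [if_pos hjN]
        split_ifs with h
        · rwa [hd0]
        · rwa [← hy _ (not_lt.1 h)]
      · rw [if_neg hjN, if_neg (by omega)]
        exact IsClose.refl hη.le y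
  · intro j hj
    exact if_neg (not_lt.2 ((Nat.le_div_iff_mul_le hm0).2 hj))
  · intro j
    dsimp only
    split_ifs with h
    · exact hdd _ _
    · rw [hy _ (not_lt.1 h), dist_self]
      exact hε

/-- Close points are joined by a small path: the uniform limit of the step functions that run
through successive refinements of a chain. -/
lemma IsClose.exists_path {ε : ℝ} (hε : 0 < ε) {x y : X} (h : IsClose ε x y) :
    ∃ g : ℝ → X, Continuous g ∧ g 0 = x ∧ g 1 = y ∧ ∀ t, dist x (g t) ≤ 3 * ε := by
  -- A stage of the construction is a chain from `x` to `y` together with its number of links.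
  let S := {p : ℕ × (ℕ → X) // 0 < p.1 ∧ p.2 0 = x ∧ ∀ j, p.1 ≤ j → p.2 j = y}
  have hstep : ∀ (k : ℕ) (p : S), (∀ j, IsClose (ε / 2 ^ k) (p.1.2 j) (p.1.2 (j + 1))) →
      ∃ q : S, (∀ j, IsClose (ε / 2 ^ (k + 1)) (q.1.2 j) (q.1.2 (j + 1))) ∧
        ∃ m, 0 < m ∧ q.1.1 = p.1.1 * m ∧ ∀ j, dist (p.1.2 (j / m)) (q.1.2 j) ≤ ε / 2 ^ k := by
    rintro k ⟨⟨N, c⟩, hN, hc0, hcy⟩ hc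
    obtain ⟨m, c', hm, h0, h1, h2, h3⟩ := exists_refined_chain (ε := ε / 2 ^ k)
      (η := ε / 2 ^ (k + 1)) (by positivity) (by positivity) hN hc hcy
    exact ⟨⟨⟨N * m, c'⟩, Nat.mul_pos hN hm, h0.trans hc0, h2⟩, h1, m, hm, rfl, h3⟩
  let S' : ℕ → Type _ := fun k => {p : S // ∀ j, IsClose (ε / 2 ^ k) (p.1.2 j) (p.1.2 (j + 1))}
  have hinit : ∃ p : S, (∀ j, IsClose (ε / 2 ^ 0) (p.1.2 j) (p.1.2 (j + 1))) ∧
      ∀ j, dist x (p.1.2 j) ≤ ε := by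
    refine ⟨⟨⟨1, fun j => if j = 0 then x else y⟩, one_pos, by simp, fun j (hj : 1 ≤ j) =>
      if_neg (by omega)⟩, fun j => ?_, fun j => ?_⟩
    · simp only [pow_zero, div_one, Nat.add_eq_zero_iff, one_ne_zero, and_false, if_false]
      split_ifs
      · exact h
      · exact IsClose.refl hε.le y
    · dsimp only
      split_ifs
      · rw [dist_self]; exact hε.le
      · exact h.dist_le
  obtain ⟨p₀, hp₀, hp₀x⟩ := hinit
  choose F hF1 m hm hFN hFd using hstep
  let P : (k : ℕ) → S' k := fun k => Nat.rec (motive := S') ⟨p₀, hp₀⟩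
    (fun k p => ⟨F k p.1 p.2, hF1 k p.1 p.2⟩) k
  let N : ℕ → ℕ := fun k => (P k).1.1.1
  let c : ℕ → ℕ → X := fun k => (P k).1.1.2
  have hN : ∀ k, 0 < N k := fun k => (P k).1.2.1
  have hc0 : ∀ k, c k 0 = x := fun k => (P k).1.2.2.1
  have hcy : ∀ k j, N k ≤ j → c k j = y := fun k => (P k).1.2.2.2
  have hcc : ∀ k j, IsClose (ε / 2 ^ k) (c k j) (c k (j + 1)) := fun k => (P k).2
  have hcN : ∀ k, ∃ m, 0 < m ∧ N (k + 1) = N k * m ∧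
      ∀ j, dist (c k (j / m)) (c (k + 1) j) ≤ ε / 2 ^ k := fun k =>
    ⟨m k (P k).1 (P k).2, hm k _ _, hFN k _ _, hFd k _ _⟩
  have hc0x : ∀ j, dist x (c 0 j) ≤ ε := hp₀x
  let G : ℕ → ℝ → X := fun k t => c k ⌊t * N k⌋₊
  have hGd : ∀ t k, dist (G k t) (G (k + 1) t) ≤ 2 * ε / 2 / 2 ^ k := by
    intro t k
    obtain ⟨m, hm, hNm, hd⟩ := hcN k
    have hfl : ⌊t * N (k + 1)⌋₊ / m = ⌊t * N k⌋₊ := by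
      rw [← Nat.floor_div_natCast, hNm, Nat.cast_mul, ← mul_assoc,
        mul_div_cancel_right₀ _ (Nat.cast_ne_zero.2 hm.ne')]
    have := hd ⌊t * N (k + 1)⌋₊
    rw [hfl] at this
    rwa [mul_div_cancel_left₀ _ (two_ne_zero (α := ℝ))]
  choose g hg using fun t => cauchySeq_tendsto_of_complete (cauchySeq_of_le_geometric_two (hGd t))
  have hgd : ∀ t k, dist (G k t) (g t) ≤ 2 * ε / 2 ^ k := fun t k =>
    dist_le_of_le_geometric_two_of_tendsto (hGd t) (hg t) k
  have hosc : ∀ (k : ℕ) (s t : ℝ), |s - t| * (N k : ℝ) < 1 → dist (G k s) (G k t) ≤ ε / 2 ^ k := by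
    intro k
    have key : ∀ s t : ℝ, s ≤ t → |s - t| * (N k : ℝ) < 1 → dist (G k s) (G k t) ≤ ε / 2 ^ k := by
      intro s t hst hlt
      have hNk : (0 : ℝ) < N k := Nat.cast_pos.2 (hN k)
      rw [abs_sub_comm, abs_of_nonneg (sub_nonneg.2 hst), sub_mul] at hlt
      have h1 : ⌊s * N k⌋₊ ≤ ⌊t * N k⌋₊ :=
        Nat.floor_le_floor (mul_le_mul_of_nonneg_right hst hNk.le)
      have h2 : ⌊t * N k⌋₊ ≤ ⌊s * N k⌋₊ + 1 := by
        refine Nat.lt_succ_iff.1 ((Nat.floor_lt' (Nat.succ_ne_zero _)).2 ?_)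
        push_cast
        have := Nat.lt_floor_add_one (s * N k)
        linarith
      have h3 : ⌊t * N k⌋₊ = ⌊s * N k⌋₊ ∨ ⌊t * N k⌋₊ = ⌊s * N k⌋₊ + 1 := by omega
      show dist (c k _) (c k _) ≤ _
      rcases h3 with h3 | h3
      · rw [h3, dist_self]; positivity
      · rw [h3]; exact (hcc k _).dist_le
    intro s t hlt
    rcases le_total s t with h | h
    · exact key s t h hlt
    · rw [dist_comm]
      exact key t s h (by rwa [abs_sub_comm])
  refine ⟨g, Metric.continuous_iff.2 fun t η hη => ?_, ?_, ?_, fun t => ?_⟩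
  · obtain ⟨k, hk⟩ : ∃ k : ℕ, 5 * ε / 2 ^ k < η := by
      obtain ⟨k, hk⟩ := exists_pow_lt_of_lt_one (div_pos hη (by positivity : 0 < 5 * ε))
        (by norm_num : (1 / 2 : ℝ) < 1)
      refine ⟨k, ?_⟩
      rw [lt_div_iff₀ (by positivity), one_div, inv_pow] at hk
      rwa [div_eq_inv_mul]
    have hNk : (0 : ℝ) < N k := Nat.cast_pos.2 (hN k)
    refine ⟨1 / N k, by positivity, fun s hs => ?_⟩
    rw [Real.dist_eq, lt_div_iff₀ hNk] at hs
    have h1 := hosc k s t hs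
    have h2 := hgd s k
    have h3 := hgd t k
    rw [dist_comm] at h2
    have h4 : 5 * ε / 2 ^ k = 2 * ε / 2 ^ k + ε / 2 ^ k + 2 * ε / 2 ^ k := by ring
    linarith [dist_triangle4 (g s) (G k s) (G k t) (g t)]
  · refine tendsto_nhds_unique (hg 0) ?_
    have : (fun k => G k 0) = fun _ => x := by
      funext k
      show c k _ = x
      rw [zero_mul, Nat.floor_zero, hc0]
    rw [this]
    exact tendsto_const_nhds
  · refine tendsto_nhds_unique (hg 1) ?_
    have : (fun k => G k 1) = fun _ => y := by
      funext k
      show c k _ = y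
      rw [one_mul, Nat.floor_natCast]
      exact hcy k _ le_rfl
    rw [this]
    exact tendsto_const_nhds
  · have h1 := hgd t 0
    have h2 : dist x (G 0 t) ≤ ε := hc0x _
    rw [pow_zero, div_one] at h1
    linarith [dist_triangle x (G 0 t) (g t)]

/-- Compact locally connected metric spaces are locally path connected. -/
lemma locallyPathConnectedSpace_of_compact : LocallyPathConnectedSpace X := by
  refine locallyPathConnectedSpace_iff_pathComponentIn_mem_nhds.2 fun x u hu hx => ?_
  obtain ⟨ε, hε, hεu⟩ := Metric.isOpen_iff.1 hu x hx
  obtain ⟨δ, hδ, hulc⟩ := exists_uniform_small_continuum (X := X) (ε := ε / 4) (by positivity)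
  filter_upwards [Metric.ball_mem_nhds x hδ] with y hy
  obtain ⟨T, hT, hxT, hyT, hTε⟩ := hulc x y (by rw [dist_comm]; exact hy)
  obtain ⟨g, hg, hg0, hg1, hgd⟩ := IsClose.exists_path (ε := ε / 4) (by positivity)
    ⟨T, hT.2.isPreconnected, hxT, hyT, hTε⟩
  refine JoinedIn.ofLine hg.continuousOn hg0 hg1 ?_
  rintro _ ⟨t, -, rfl⟩
  refine hεu (Metric.mem_ball'.2 ?_)
  linarith [hgd t]

end Paths

/-! ### Arcs and simple closed curves -/

section Arcs

variable {X : Type*}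

/-- Closed sets of parameters whose gaps are loops of `γ`: cutting out these loops leaves a path. -/
def IsLoopErasure (γ : ℝ → X) (K : Set ℝ) : Prop :=
  IsClosed K ∧ K ⊆ Icc 0 1 ∧ 0 ∈ K ∧ 1 ∈ K ∧
    ∀ s ∈ K, ∀ t ∈ K, s < t → Disjoint (Ioo s t) K → γ s = γ t

/-- In a closed set of reals, the greatest point that is at most `m`. -/
lemma exists_isGreatest_inter_Iic {K : Set ℝ} (hK : IsClosed K) {s m : ℝ} (hs : s ∈ K)
    (hsm : s ≤ m) : ∃ r, IsGreatest (K ∩ Iic m) r :=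
  ⟨_, (hK.inter isClosed_Iic).csSup_mem ⟨s, hs, hsm⟩ ⟨m, fun _ h => h.2⟩,
    fun _ h => le_csSup ⟨m, fun _ h => h.2⟩ h⟩

lemma exists_isLeast_inter_Ici {K : Set ℝ} (hK : IsClosed K) {t m : ℝ} (ht : t ∈ K)
    (hmt : m ≤ t) : ∃ r, IsLeast (K ∩ Ici m) r :=
  ⟨_, (hK.inter isClosed_Ici).csInf_mem ⟨t, ht, hmt⟩ ⟨m, fun _ h => h.2⟩,
    fun _ h => csInf_le ⟨m, fun _ h => h.2⟩ h⟩

/-- The end points of the gap of a loop erasure at a parameter `m` have the same image. -/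
lemma IsLoopErasure.eq_of_isGreatest_of_isLeast {γ : ℝ → X} {K : Set ℝ} (hK : IsLoopErasure γ K)
    {m r l : ℝ} (hr : IsGreatest (K ∩ Iic m) r) (hl : IsLeast (K ∩ Ici m) l) : γ r = γ l := by
  rcases (hr.1.2.trans hl.1.2 : r ≤ l).eq_or_lt with h | h
  · rw [h]
  refine hK.2.2.2.2 r hr.1.1 l hl.1.1 h (disjoint_left.2 fun z hz hzK => ?_)
  rcases le_total z m with hzm | hzm
  · exact not_le.2 hz.1 (hr.2 ⟨hzK, hzm⟩)
  · exact not_le.2 hz.2 (hl.2 ⟨hzK, hzm⟩)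

/-- By Zorn's lemma there is a minimal loop erasure. -/
lemma exists_minimal_isLoopErasure [MetricSpace X] {γ : ℝ → X} (hγ : Continuous γ) :
    ∃ K, Minimal (IsLoopErasure γ) K := by
  have huniv : IsLoopErasure γ (Icc 0 1) := by
    refine ⟨isClosed_Icc, subset_rfl, ⟨le_rfl, zero_le_one⟩, ⟨zero_le_one, le_rfl⟩, ?_⟩
    intro s hs t ht hst hd
    exact absurd ⟨by linarith [hs.1], by linarith [ht.2]⟩
      (disjoint_left.1 hd (show (s + t) / 2 ∈ Ioo s t from ⟨by linarith, by linarith⟩))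
  suffices H : ∀ c ⊆ {K | IsLoopErasure γ K}, IsChain (· ⊆ ·) c → c.Nonempty →
      ⋂₀ c ∈ {K | IsLoopErasure γ K} by
    obtain ⟨K, -, hK⟩ := zorn_superset_nonempty {K | IsLoopErasure γ K}
      (fun c hc hchain hne => ⟨⋂₀ c, H c hc hchain hne, fun s hs => sInter_subset_of_mem hs⟩)
      _ huniv
    exact ⟨K, hK⟩
  intro c hc hchain hne
  show IsLoopErasure γ (⋂₀ c)
  have hcl : IsClosed (⋂₀ c) := isClosed_sInter fun K hK => (hc hK).1
  obtain ⟨K₀, hK₀⟩ := hne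
  refine ⟨hcl, (sInter_subset_of_mem hK₀).trans (hc hK₀).2.1, fun K hK => (hc hK).2.2.1,
    fun K hK => (hc hK).2.2.2.1, fun s hs t ht hst hd => ?_⟩
  -- Members of the chain have gaps whose end points are arbitrarily close to `s` and `t`.
  have hgap : ∀ η > 0, η < (t - s) / 2 →
      ∃ s' ∈ Icc s (s + η), ∃ t' ∈ Icc (t - η) t, γ s' = γ t' := by
    intro η hη hηst
    have hemp : Icc (s + η) (t - η) ∩ ⋂ K : c, (K : Set ℝ) = ∅ := by
      rw [← sInter_eq_iInter, ← disjoint_iff_inter_eq_empty]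
      exact hd.mono_left (Icc_subset_Ioo (by linarith) (by linarith))
    have : Nonempty c := ⟨⟨K₀, hK₀⟩⟩
    obtain ⟨⟨K, hK⟩, hKe⟩ := isCompact_Icc.elim_directed_family_closed (fun K : c => (K : Set ℝ))
      (fun K => (hc K.2).1) hemp (fun A B => by
        rcases hchain.total A.2 B.2 with h | h
        · exact ⟨A, subset_rfl, h⟩
        · exact ⟨B, h, subset_rfl⟩)
    obtain ⟨r, hr⟩ := exists_isGreatest_inter_Iic (hc hK).1 (hs K hK)
      (show s ≤ (s + t) / 2 by linarith)
    obtain ⟨l, hl⟩ := exists_isLeast_inter_Ici (hc hK).1 (ht K hK)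
      (show (s + t) / 2 ≤ t by linarith)
    have hr1 : r ≤ (s + t) / 2 := hr.1.2
    have hl1 : (s + t) / 2 ≤ l := hl.1.2
    refine ⟨r, ⟨hr.2 ⟨hs K hK, by simp only [mem_Iic]; linarith⟩, ?_⟩, l, ⟨?_,
      hl.2 ⟨ht K hK, by simp only [mem_Ici]; linarith⟩⟩,
      IsLoopErasure.eq_of_isGreatest_of_isLeast (hc hK) hr hl⟩
    · by_contra hcon
      have : r ∈ Icc (s + η) (t - η) ∩ K := ⟨⟨by linarith, by linarith⟩, hr.1.1⟩
      rw [hKe] at this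
      exact this
    · by_contra hcon
      have : l ∈ Icc (s + η) (t - η) ∩ K := ⟨⟨by linarith, by linarith⟩, hl.1.1⟩
      rw [hKe] at this
      exact this
  refine eq_of_forall_dist_le fun ε hε => ?_
  obtain ⟨δ₁, hδ₁, h1⟩ := Metric.continuous_iff.1 hγ s (ε / 2) (half_pos hε)
  obtain ⟨δ₂, hδ₂, h2⟩ := Metric.continuous_iff.1 hγ t (ε / 2) (half_pos hε)
  obtain ⟨η, hη, hηlt⟩ := exists_between (lt_min (lt_min hδ₁ hδ₂)
    (show 0 < (t - s) / 2 by linarith))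
  rw [lt_min_iff, lt_min_iff] at hηlt
  obtain ⟨s', hs', t', ht', he⟩ := hgap η hη hηlt.2
  have h1' := h1 s' (by
    rw [Real.dist_eq, abs_lt]; constructor <;> linarith [hs'.1, hs'.2, hηlt.1.1])
  have h2' := h2 t' (by
    rw [Real.dist_eq, abs_lt]; constructor <;> linarith [ht'.1, ht'.2, hηlt.1.2])
  rw [he, dist_comm] at h1'
  linarith [dist_triangle (γ s) (γ t') (γ t)]

/-- Points of a minimal loop erasure with the same image bound a gap, since the part between them
could be erased as well. -/
lemma disjoint_Ioo_of_minimal {γ : ℝ → X} {K : Set ℝ} (hK : Minimal (IsLoopErasure γ) K) {s t : ℝ}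
    (hs : s ∈ K) (ht : t ∈ K) (he : γ s = γ t) : Disjoint (Ioo s t) K := by
  have hK' := hK.prop
  have hs0 := (hK'.2.1 hs).1
  have ht1 := (hK'.2.1 ht).2
  have h : IsLoopErasure γ (K \ Ioo s t) := by
    refine ⟨hK'.1.sdiff isOpen_Ioo, sdiff_subset.trans hK'.2.1, ⟨hK'.2.2.1, fun h => ?_⟩,
      ⟨hK'.2.2.2.1, fun h => ?_⟩, fun u hu v hv huv hd => ?_⟩
    · exact not_le.2 h.1 hs0
    · exact not_le.2 h.2 ht1
    by_cases hd' : Disjoint (Ioo u v) K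
    · exact hK'.2.2.2.2 u hu.1 v hv.1 huv hd'
    obtain ⟨w, hw, hwK⟩ := not_disjoint_iff.1 hd'
    have hwst : w ∈ Ioo s t := by
      by_contra hcon
      exact disjoint_left.1 hd hw ⟨hwK, hcon⟩
    have hsd : s ∉ Ioo u v := fun h => disjoint_left.1 hd h ⟨hs, fun h' => lt_irrefl _ h'.1⟩
    have htd : t ∉ Ioo u v := fun h => disjoint_left.1 hd h ⟨ht, fun h' => lt_irrefl _ h'.2⟩
    have hu1 : u = s := by
      refine le_antisymm ?_ ?_
      · by_contra hcon
        exact hu.2 ⟨not_le.1 hcon, hw.1.trans hwst.2⟩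
      · by_contra hcon
        exact hsd ⟨not_le.1 hcon, hwst.1.trans hw.2⟩
    have hv1 : v = t := by
      refine le_antisymm ?_ ?_
      · by_contra hcon
        exact htd ⟨hw.1.trans hwst.2, not_le.1 hcon⟩
      · by_contra hcon
        exact hv.2 ⟨hwst.1.trans hw.2, not_le.1 hcon⟩
    rw [hu1, hv1, he]
  exact disjoint_left.2 fun z hz hzK => (hK.le_of_le h sdiff_subset hzK).2 hz

variable [MetricSpace X]

/-- Every path can be cut down to a path with connected fibres. -/
lemma exists_path_constant_between {γ : ℝ → X} (hγ : Continuous γ) :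
    ∃ β : ℝ → X, Continuous β ∧ β 0 = γ 0 ∧ β 1 = γ 1 ∧
      (∀ t ∈ Icc (0 : ℝ) 1, ∃ s ∈ Icc (0 : ℝ) 1, β t = γ s) ∧
      ∀ s ∈ Icc (0 : ℝ) 1, ∀ t ∈ Icc (0 : ℝ) 1, β s = β t → ∀ u ∈ Icc s t, β u = β s := by
  suffices H : ∃ β : ℝ → X, ContinuousOn β (Icc 0 1) ∧ β 0 = γ 0 ∧ β 1 = γ 1 ∧
      (∀ t ∈ Icc (0 : ℝ) 1, ∃ s ∈ Icc (0 : ℝ) 1, β t = γ s) ∧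
      ∀ s ∈ Icc (0 : ℝ) 1, ∀ t ∈ Icc (0 : ℝ) 1, β s = β t → ∀ u ∈ Icc s t, β u = β s by
    obtain ⟨β, hβ, h0, h1, him, hfib⟩ := H
    have he : ∀ t ∈ Icc (0 : ℝ) 1, IccExtend zero_le_one ((Icc (0 : ℝ) 1).domRestrict β) t = β t :=
      fun t ht => IccExtend_of_mem _ _ ht
    refine ⟨IccExtend zero_le_one ((Icc (0 : ℝ) 1).domRestrict β),
      hβ.domRestrict.Icc_extend', ?_, ?_, fun t ht => ?_, fun s hs t ht hst u hu => ?_⟩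
    · rw [he 0 ⟨le_rfl, zero_le_one⟩, h0]
    · rw [he 1 ⟨zero_le_one, le_rfl⟩, h1]
    · rw [he t ht]
      exact him t ht
    · rw [he s hs, he t ht] at hst
      rw [he u ⟨hs.1.trans hu.1, hu.2.trans ht.2⟩, he s hs]
      exact hfib s hs t ht hst u hu
  obtain ⟨K, hKm⟩ := exists_minimal_isLoopErasure hγ
  have hK := hKm.prop
  have hex : ∀ t : ℝ, ∃ r, 0 ≤ t → IsGreatest (K ∩ Iic t) r := by
    intro t
    by_cases ht : 0 ≤ t
    · obtain ⟨r, hr⟩ := exists_isGreatest_inter_Iic hK.1 hK.2.2.1 ht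
      exact ⟨r, fun _ => hr⟩
    · exact ⟨0, fun h => absurd h ht⟩
  choose r hr using hex
  have hrK : ∀ t, 0 ≤ t → r t ∈ K := fun t ht => (hr t ht).1.1
  have hrt : ∀ t, 0 ≤ t → r t ≤ t := fun t ht => (hr t ht).1.2
  have hrle : ∀ t, 0 ≤ t → ∀ k ∈ K, k ≤ t → k ≤ r t := fun t ht k hk hkt => (hr t ht).2 ⟨hk, hkt⟩
  have hr_of_mem : ∀ k ∈ K, r k = k := fun k hk =>
    le_antisymm (hrt k (hK.2.1 hk).1) (hrle k (hK.2.1 hk).1 k hk le_rfl)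
  have hmono : ∀ s t, 0 ≤ s → s ≤ t → r s ≤ r t := fun s t hs hst =>
    hrle t (hs.trans hst) _ (hrK s hs) ((hrt s hs).trans hst)
  -- Two values of `γ ∘ r` are values of `γ` at parameters in between.
  have hbetween : ∀ s t, 0 ≤ s → s ≤ t → t ≤ 1 → γ (r s) = γ (r t) ∨
      ∃ s' ∈ Icc s t, ∃ t' ∈ Icc s t, γ (r s) = γ s' ∧ γ (r t) = γ t' := by
    intro s t hs hst ht
    rcases le_or_gt (r t) s with h | h
    · left
      rw [le_antisymm (hrle s hs _ (hrK t (hs.trans hst)) h) (hmono s t hs hst)]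
    · right
      obtain ⟨l, hl⟩ := exists_isLeast_inter_Ici hK.1 (hrK t (hs.trans hst)) h.le
      have hlr : l ≤ r t := hl.2 ⟨hrK t (hs.trans hst), h.le⟩
      exact ⟨l, ⟨hl.1.2, hlr.trans (hrt t (hs.trans hst))⟩, r t, ⟨h.le, hrt t (hs.trans hst)⟩,
        hK.eq_of_isGreatest_of_isLeast (hr s hs) hl, rfl⟩
  refine ⟨fun t => γ (r t), ?_, ?_, ?_, fun t ht => ⟨r t, hK.2.1 (hrK t ht.1), rfl⟩, ?_⟩
  · refine Metric.continuousOn_iff.2 fun t ht ε hε => ?_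
    obtain ⟨δ, hδ, h⟩ := Metric.continuous_iff.1 hγ t (ε / 2) (half_pos hε)
    refine ⟨δ, hδ, fun s hs hst => ?_⟩
    have key : ∀ a b : ℝ, 0 ≤ a → a ≤ b → b ≤ 1 → (∀ u ∈ Icc a b, dist u t < δ) →
        dist (γ (r a)) (γ (r b)) < ε := by
      intro a b ha hab hb hclose
      rcases hbetween a b ha hab hb with he | ⟨a', ha', b', hb', he1, he2⟩
      · rw [he, dist_self]; exact hε
      · rw [he1, he2]
        have h1 := h a' (hclose a' ha')
        have h2 := h b' (hclose b' hb')
        rw [dist_comm] at h2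
        linarith [dist_triangle (γ a') (γ t) (γ b')]
    rw [Real.dist_eq, abs_lt] at hst
    rcases le_total s t with hle | hle
    · refine key s t hs.1 hle ht.2 fun u hu => ?_
      rw [Real.dist_eq, abs_lt]
      constructor <;> linarith [hu.1, hu.2]
    · rw [dist_comm]
      refine key t s ht.1 hle hs.2 fun u hu => ?_
      rw [Real.dist_eq, abs_lt]
      constructor <;> linarith [hu.1, hu.2]
  · simp only [hr_of_mem 0 hK.2.2.1]
  · simp only [hr_of_mem 1 hK.2.2.2.1]
  · intro s hs t ht he u hu
    dsimp only at he ⊢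
    have hu0 : 0 ≤ u := hs.1.trans hu.1
    have h1 := hmono s u hs.1 hu.1
    have h2 := hmono u t hu0 hu.2
    rcases h1.eq_or_lt with h | h
    · rw [h]
    rcases h2.eq_or_lt with h' | h'
    · rw [h', he]
    exact absurd (hrK u hu0) (disjoint_left.1 (disjoint_Ioo_of_minimal hKm (hrK s hs.1) (hrK t ht.1)
      he) ⟨h, h'⟩)

/-- How close the path `β` has come to the point `d` up to time `t`, on a scale from `0` to `1`. -/
noncomputable def pathReach (d : X) (β : ℝ → X) (t : ℝ) : ℝ :=
  sSup ((fun u => 1 / (1 + dist (β (t * u)) d)) '' Icc (0 : ℝ) 1)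

lemma one_div_one_add_dist_mem_Icc (x d : X) : 1 / (1 + dist x d) ∈ Icc (0 : ℝ) 1 := by
  have := dist_nonneg (x := x) (y := d)
  refine ⟨by positivity, ?_⟩
  rw [div_le_one (by positivity)]
  linarith

lemma le_pathReach (d : X) (β : ℝ → X) {w t : ℝ} (hw : w ∈ Icc 0 t) :
    1 / (1 + dist (β w) d) ≤ pathReach d β t := by
  have ht : 0 ≤ t := hw.1.trans hw.2
  refine le_csSup ⟨1, ?_⟩ ⟨w / t, ⟨div_nonneg hw.1 ht, div_le_one_of_le₀ hw.2 ht⟩, ?_⟩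
  · rintro _ ⟨u, -, rfl⟩
    exact (one_div_one_add_dist_mem_Icc _ _).2
  · dsimp only
    rw [mul_div_cancel_of_imp']
    rintro rfl
    exact le_antisymm hw.2 hw.1

lemma pathReach_le {d : X} {β : ℝ → X} {t c : ℝ} (ht : 0 ≤ t)
    (h : ∀ w ∈ Icc 0 t, 1 / (1 + dist (β w) d) ≤ c) : pathReach d β t ≤ c := by
  refine csSup_le ⟨_, mem_image_of_mem _ (left_mem_Icc.2 zero_le_one)⟩ ?_
  rintro _ ⟨u, hu, rfl⟩
  exact h _ ⟨mul_nonneg ht hu.1, mul_le_of_le_one_right ht hu.2⟩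

lemma norm_pathReach_le (d : X) (β : ℝ → X) (t : ℝ) : ‖pathReach d β t‖ ≤ 1 := by
  have hne : ((fun u => 1 / (1 + dist (β (t * u)) d)) '' Icc (0 : ℝ) 1).Nonempty :=
    ⟨_, mem_image_of_mem _ (left_mem_Icc.2 zero_le_one)⟩
  rw [Real.norm_eq_abs, abs_le]
  constructor
  · refine le_trans (by norm_num) (Real.sSup_nonneg ?_)
    rintro _ ⟨u, -, rfl⟩
    exact (one_div_one_add_dist_mem_Icc _ _).1
  · refine csSup_le hne ?_
    rintro _ ⟨u, -, rfl⟩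
    exact (one_div_one_add_dist_mem_Icc _ _).2

lemma continuous_pathReach (d : X) {β : ℝ → X} (hβ : Continuous β) :
    Continuous (pathReach d β) := by
  refine isCompact_Icc.continuous_sSup (f := fun t u => 1 / (1 + dist (β (t * u)) d)) ?_
  refine continuous_const.div (continuous_const.add
    ((hβ.comp (continuous_fst.mul continuous_snd)).dist continuous_const)) fun p => ?_
  have := dist_nonneg (x := β (p.1 * p.2)) (y := d)
  positivity

/-- A measure of how much of `X` the path `β` has visited up to time `t`: a weighted sum of its
reaches of the members of a dense sequence `d`. -/
noncomputable def pathExtent (d : ℕ → X) (β : ℝ → X) (t : ℝ) : ℝ :=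
  ∑' n : ℕ, (1 / 2 : ℝ) ^ n * pathReach (d n) β t

lemma norm_pathExtent_term_le (d : ℕ → X) (β : ℝ → X) (n : ℕ) (t : ℝ) :
    ‖(1 / 2 : ℝ) ^ n * pathReach (d n) β t‖ ≤ (1 / 2 : ℝ) ^ n := by
  rw [norm_mul, Real.norm_of_nonneg (by positivity : (0 : ℝ) ≤ (1 / 2) ^ n)]
  exact mul_le_of_le_one_right (by positivity) (norm_pathReach_le _ _ _)

lemma summable_pathExtent (d : ℕ → X) (β : ℝ → X) (t : ℝ) :
    Summable fun n : ℕ => (1 / 2 : ℝ) ^ n * pathReach (d n) β t :=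
  Summable.of_norm_bounded summable_geometric_two fun n => norm_pathExtent_term_le d β n t

lemma continuous_pathExtent (d : ℕ → X) {β : ℝ → X} (hβ : Continuous β) :
    Continuous (pathExtent d β) :=
  continuous_tsum (fun n => continuous_const.mul (continuous_pathReach (d n) hβ))
    summable_geometric_two fun n t => norm_pathExtent_term_le d β n t

lemma pathReach_le_pathReach (d : X) {β : ℝ → X} {s t : ℝ} (hs : 0 ≤ s)
    (h : ∀ v ∈ Icc 0 s, ∃ w ∈ Icc 0 t, β v = β w) : pathReach d β s ≤ pathReach d β t :=
  pathReach_le hs fun v hv => by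
    obtain ⟨w, hw, he⟩ := h v hv
    rw [he]
    exact le_pathReach d β hw

lemma pathExtent_le_pathExtent (d : ℕ → X) {β : ℝ → X} {s t : ℝ} (hs : 0 ≤ s)
    (h : ∀ v ∈ Icc 0 s, ∃ w ∈ Icc 0 t, β v = β w) : pathExtent d β s ≤ pathExtent d β t :=
  (summable_pathExtent d β s).tsum_le_tsum (fun n => mul_le_mul_of_nonneg_left
    (pathReach_le_pathReach (d n) hs h) (by positivity)) (summable_pathExtent d β t)

lemma pathExtent_lt_pathExtent {d : ℕ → X} (hd : DenseRange d) {β : ℝ → X} (hβ : Continuous β)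
    {s t : ℝ} (hs : 0 ≤ s) (hst : s ≤ t) (h : ∀ v ∈ Icc 0 s, β v ≠ β t) :
    pathExtent d β s < pathExtent d β t := by
  have hsub : ∀ v ∈ Icc 0 s, ∃ w ∈ Icc 0 t, β v = β w := fun v hv =>
    ⟨v, ⟨hv.1, hv.2.trans hst⟩, rfl⟩
  have hclosed : IsClosed (β '' Icc 0 s) := (isCompact_Icc.image hβ).isClosed
  have hmem : β t ∉ β '' Icc 0 s := by
    rintro ⟨v, hv, he⟩
    exact h v hv he
  obtain ⟨η, hη, hball⟩ := Metric.isOpen_iff.1 hclosed.isOpen_compl _ hmem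
  obtain ⟨n, hn⟩ := hd.exists_dist_lt (β t) (show 0 < η / 3 by positivity)
  refine Summable.tsum_lt_tsum (i := n) (fun n => mul_le_mul_of_nonneg_left
    (pathReach_le_pathReach (d n) hs hsub) (by positivity))
    (mul_lt_mul_of_pos_left ?_ (by positivity)) (summable_pathExtent d β s)
    (summable_pathExtent d β t)
  have h1 : pathReach (d n) β s ≤ 1 / (1 + 2 * (η / 3)) := by
    refine pathReach_le hs fun v hv => one_div_le_one_div_of_le (by positivity) ?_
    have hv' : η ≤ dist (β v) (β t) := by
      by_contra hcon
      exact hball (Metric.mem_ball.2 (not_le.1 hcon)) (mem_image_of_mem _ hv)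
    have := dist_triangle (β v) (d n) (β t)
    rw [dist_comm (d n)] at this
    linarith
  have h2 := le_pathReach (d n) β (right_mem_Icc.2 (hs.trans hst))
  have h3 : 1 / (1 + 2 * (η / 3)) < 1 / (1 + dist (β t) (d n)) :=
    one_div_lt_one_div_of_lt (by positivity) (by linarith)
  linarith

/-- A path between distinct points can be cut down to an injective path: make its fibres connected
and parametrize the result by its extent. -/
lemma exists_injOn_path [CompactSpace X] {γ : ℝ → X} (hγ : Continuous γ) (hne : γ 0 ≠ γ 1) :
    ∃ σ : ℝ → X, ContinuousOn σ (Icc 0 1) ∧ InjOn σ (Icc 0 1) ∧ σ 0 = γ 0 ∧ σ 1 = γ 1 ∧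
      ∀ t ∈ Icc (0 : ℝ) 1, ∃ s ∈ Icc (0 : ℝ) 1, σ t = γ s := by
  obtain ⟨β, hβ, hβ0, hβ1, him, hfib⟩ := exists_path_constant_between hγ
  have : Nonempty X := ⟨γ 0⟩
  set φ := pathExtent (TopologicalSpace.denseSeq X) β with hφ
  have hφc : Continuous φ := continuous_pathExtent _ hβ
  have hmono : ∀ s t, 0 ≤ s → s ≤ t → φ s ≤ φ t := fun s t hs hst =>
    pathExtent_le_pathExtent _ hs fun v hv => ⟨v, ⟨hv.1, hv.2.trans hst⟩, rfl⟩
  have hiff : ∀ s ∈ Icc (0 : ℝ) 1, ∀ t ∈ Icc (0 : ℝ) 1, φ s = φ t ↔ β s = β t := by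
    have key : ∀ s ∈ Icc (0 : ℝ) 1, ∀ t ∈ Icc (0 : ℝ) 1, s ≤ t → (φ s = φ t ↔ β s = β t) := by
      intro s hs t ht hst
      constructor
      · intro he
        by_contra hcon
        refine (pathExtent_lt_pathExtent (TopologicalSpace.denseRange_denseSeq X) hβ hs.1 hst
          fun v hv hvt => hcon ?_).ne he
        rw [hfib v ⟨hv.1, hv.2.trans hs.2⟩ t ht hvt s ⟨hv.2, hst⟩, hvt]
      · intro he
        refine le_antisymm (hmono s t hs.1 hst) (pathExtent_le_pathExtent _ ht.1 fun v hv => ?_)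
        rcases le_total v s with h | h
        · exact ⟨v, ⟨hv.1, h⟩, rfl⟩
        · exact ⟨s, ⟨hs.1, le_rfl⟩, hfib s hs t ht he v ⟨h, hv.2⟩⟩
    intro s hs t ht
    rcases le_total s t with h | h
    · exact key s hs t ht h
    · rw [eq_comm, key t ht s hs h, eq_comm]
  have h0 : (0 : ℝ) ∈ Icc (0 : ℝ) 1 := ⟨le_rfl, zero_le_one⟩
  have h1 : (1 : ℝ) ∈ Icc (0 : ℝ) 1 := ⟨zero_le_one, le_rfl⟩
  have hlt : φ 0 < φ 1 := (hmono 0 1 le_rfl zero_le_one).lt_of_ne fun he =>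
    hne (by rw [← hβ0, ← hβ1]; exact (hiff 0 h0 1 h1).1 he)
  -- `ψ` is `φ`, rescaled to a map onto the unit interval.
  set ψ : ℝ → ℝ := fun t => (φ t - φ 0) / (φ 1 - φ 0) with hψ
  have hψc : Continuous ψ := (hφc.sub continuous_const).div_const _
  have hψiff : ∀ s ∈ Icc (0 : ℝ) 1, ∀ t ∈ Icc (0 : ℝ) 1, ψ s = ψ t ↔ β s = β t := by
    intro s hs t ht
    rw [← hiff s hs t ht, hψ]
    dsimp only
    rw [div_left_inj' (sub_pos.2 hlt).ne', sub_left_inj]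
  have hψ0 : ψ 0 = 0 := by simp [hψ]
  have hψ1 : ψ 1 = 1 := div_self (sub_pos.2 hlt).ne'
  have hsurj : ∀ v : ℝ, ∃ t, v ∈ Icc (0 : ℝ) 1 → t ∈ Icc (0 : ℝ) 1 ∧ ψ t = v := by
    intro v
    by_cases hv : v ∈ Icc (0 : ℝ) 1
    · obtain ⟨t, ht, he⟩ := intermediate_value_Icc zero_le_one hψc.continuousOn
        (by rwa [hψ0, hψ1])
      exact ⟨t, fun _ => ⟨ht, he⟩⟩
    · exact ⟨0, fun h => absurd h hv⟩
  choose τ hτ using hsurj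
  have hτβ : ∀ t ∈ Icc (0 : ℝ) 1, ∀ v ∈ Icc (0 : ℝ) 1, ψ t = v → β (τ v) = β t := by
    intro t ht v hv he
    rw [← hψiff _ (hτ v hv).1 t ht, (hτ v hv).2, he]
  refine ⟨fun v => β (τ v), ?_, ?_, ?_, ?_, fun v hv => him _ (hτ v hv).1⟩
  · rw [continuousOn_iff_isClosed]
    intro F hF
    refine ⟨ψ '' (Icc 0 1 ∩ β ⁻¹' F),
      ((isCompact_Icc.inter_right (hF.preimage hβ)).image hψc).isClosed, ?_⟩
    ext v
    constructor
    · rintro ⟨hvF, hv⟩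
      exact ⟨⟨τ v, ⟨(hτ v hv).1, hvF⟩, (hτ v hv).2⟩, hv⟩
    · rintro ⟨⟨t, ⟨ht, htF⟩, rfl⟩, hv⟩
      refine ⟨?_, hv⟩
      show β (τ (ψ t)) ∈ F
      rw [hτβ t ht _ hv rfl]
      exact htF
  · intro v hv w hw he
    rw [← (hτ v hv).2, ← (hτ w hw).2]
    exact (hψiff _ (hτ v hv).1 _ (hτ w hw).1).2 he
  · rw [← hβ0]
    exact hτβ 0 h0 0 h0 hψ0
  · rw [← hβ1]
    exact hτβ 1 h1 1 h1 hψ1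

end Arcs

section SimpleClosedCurves

variable {X : Type*} [MetricSpace X]

/-- A loop that is injective except at its end points traverses a simple closed curve. -/
lemma isSimpleClosedCurve_image {p : ℝ} (hp : 0 < p) {g : ℝ → X} (hg : ContinuousOn g (Icc 0 p))
    (hgp : g 0 = g p) (hinj : InjOn g (Ico 0 p)) : IsSimpleClosedCurve (g '' Ico 0 p) := by
  have : Fact (0 < p) := ⟨hp⟩
  have hG : Continuous (AddCircle.liftIco p 0 g) := AddCircle.liftIco_zero_continuous hgp hg
  have hrep : ∀ x : AddCircle p, ∃ t ∈ Ico 0 p, (t : AddCircle p) = x := by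
    intro x
    refine ⟨AddCircle.equivIco p 0 x, ?_, AddCircle.coe_equivIco⟩
    have := (AddCircle.equivIco p 0 x).2
    exact ⟨this.1, this.2.trans_eq (zero_add p)⟩
  have hGinj : Function.Injective (AddCircle.liftIco p 0 g) := by
    intro x y hxy
    obtain ⟨s, hs, rfl⟩ := hrep x
    obtain ⟨t, ht, rfl⟩ := hrep y
    rw [AddCircle.liftIco_zero_coe_apply hs, AddCircle.liftIco_zero_coe_apply ht] at hxy
    rw [hinj hs ht hxy]
  have hrange : range (AddCircle.liftIco p 0 g) = g '' Ico 0 p := by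
    ext z
    constructor
    · rintro ⟨x, rfl⟩
      obtain ⟨s, hs, rfl⟩ := hrep x
      exact ⟨s, hs, (AddCircle.liftIco_zero_coe_apply hs).symm⟩
    · rintro ⟨s, hs, rfl⟩
      exact ⟨s, AddCircle.liftIco_zero_coe_apply hs⟩
  rw [← hrange]
  exact ⟨(Continuous.homeoOfEquivCompactToT2 (f := Equiv.ofInjective _ hGinj)
    (hG.subtype_mk _)).symm.trans (AddCircle.homeomorphCircle hp.ne')⟩

/-- If two points are joined by an arc through `r` and by an arc that avoids `r`, the union of the
two arcs contains a simple closed curve. -/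
lemma exists_isSimpleClosedCurve_of_arcs {σ τ : ℝ → X} (hσ : ContinuousOn σ (Icc 0 1))
    (hσi : InjOn σ (Icc 0 1)) (hτ : ContinuousOn τ (Icc 0 1)) (hτi : InjOn τ (Icc 0 1))
    (h0 : σ 0 = τ 0) (h1 : σ 1 = τ 1) {c : ℝ} (hc : c ∈ Ioo (0 : ℝ) 1)
    (hcτ : ∀ t ∈ Icc (0 : ℝ) 1, τ t ≠ σ c) :
    ∃ C ⊆ σ '' Icc 0 1 ∪ τ '' Icc 0 1, IsSimpleClosedCurve C := by
  have hclosed : ∀ a b : ℝ, 0 ≤ a → b ≤ 1 → IsClosed (σ '' Icc a b) := fun a b ha hb =>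
    (isCompact_Icc.image_of_continuousOn (hσ.mono (Icc_subset_Icc ha hb))).isClosed
  -- The last exit of `τ` from the first part of `σ` and the next entrance into the second part.
  have hP : IsClosed (Icc 0 1 ∩ τ ⁻¹' (σ '' Icc 0 c)) :=
    hτ.preimage_isClosed_of_isClosed isClosed_Icc (hclosed 0 c le_rfl hc.2.le)
  obtain ⟨s, hs⟩ := (isCompact_Icc.of_isClosed_subset hP inter_subset_left).exists_isGreatest
    ⟨0, ⟨le_rfl, zero_le_one⟩, 0, ⟨le_rfl, hc.1.le⟩, h0⟩
  have hQ : IsClosed (Icc s 1 ∩ τ ⁻¹' (σ '' Icc c 1)) :=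
    (hτ.mono (Icc_subset_Icc hs.1.1.1 le_rfl)).preimage_isClosed_of_isClosed isClosed_Icc
      (hclosed c 1 hc.1.le le_rfl)
  obtain ⟨t, ht⟩ := (isCompact_Icc.of_isClosed_subset hQ inter_subset_left).exists_isLeast
    ⟨1, ⟨hs.1.1.2, le_rfl⟩, 1, ⟨hc.2.le, le_rfl⟩, h1⟩
  obtain ⟨⟨hs01, u, hu, hus⟩, hsmax⟩ := hs
  obtain ⟨⟨hts, v, hv, hvt⟩, htmin⟩ := ht
  have ht01 : t ∈ Icc (0 : ℝ) 1 := ⟨hs01.1.trans hts.1, hts.2⟩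
  have hu01 : u ∈ Icc (0 : ℝ) 1 := ⟨hu.1, hu.2.trans hc.2.le⟩
  have hv01 : v ∈ Icc (0 : ℝ) 1 := ⟨hc.1.le.trans hv.1, hv.2⟩
  have huc : u < c := hu.2.lt_of_ne fun h => hcτ s hs01 (by rw [← hus, h])
  have hcv : c < v := hv.1.lt_of_ne fun h => hcτ t ht01 (by rw [← hvt, h])
  have hst : s < t := hts.1.lt_of_ne fun h => by
    rw [← h, ← hus] at hvt
    exact (huc.trans hcv).ne' (hσi hv01 hu01 hvt)
  have hoff : ∀ w ∈ Ioo s t, τ w ∉ σ '' Icc 0 1 := by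
    rintro w hw ⟨z, hz, hzw⟩
    have hw01 : w ∈ Icc (0 : ℝ) 1 := ⟨hs01.1.trans hw.1.le, hw.2.le.trans ht01.2⟩
    rcases le_total z c with h | h
    · exact not_le.2 hw.1 (hsmax ⟨hw01, z, ⟨hz.1, h⟩, hzw⟩)
    · exact not_le.2 hw.2 (htmin ⟨⟨hw.1.le, hw01.2⟩, z, ⟨h, hz.2⟩, hzw⟩)
  -- Run along `σ` from `u` to `v` and back along `τ`.
  let a : ℝ → ℝ := fun x => u + x * (v - u)
  let b : ℝ → ℝ := fun x => t + (x - 1) * (s - t)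
  have hac : Continuous a := by fun_prop
  have hbc : Continuous b := by fun_prop
  have ha : ∀ x, 0 ≤ x → x ≤ 1 → a x ∈ Icc (0 : ℝ) 1 := by
    intro x hx0 hx1
    have huv : 0 ≤ v - u := by linarith
    exact ⟨by have := mul_nonneg hx0 huv; linarith [hu01.1],
      by have := mul_le_of_le_one_left huv hx1; linarith [hv01.2]⟩
  have hb : ∀ x, 1 ≤ x → x ≤ 2 → b x ∈ Icc s t := by
    intro x hx1 hx2
    have h1 : 0 ≤ (x - 1) * (t - s) := mul_nonneg (by linarith) (by linarith)
    have h2 : (x - 1) * (t - s) ≤ t - s := mul_le_of_le_one_left (by linarith) (by linarith)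
    have h3 : b x = t - (x - 1) * (t - s) := by ring
    rw [h3]
    exact ⟨by linarith, by linarith⟩
  have hb' : ∀ x, 1 < x → x < 2 → b x ∈ Ioo s t := by
    intro x hx1 hx2
    have h1 : 0 < (x - 1) * (t - s) := mul_pos (by linarith) (by linarith)
    have h2 : (x - 1) * (t - s) < t - s := mul_lt_of_lt_one_left (by linarith) (by linarith)
    have h3 : b x = t - (x - 1) * (t - s) := by ring
    rw [h3]
    exact ⟨by linarith, by linarith⟩
  have hst01 : Icc s t ⊆ Icc (0 : ℝ) 1 := Icc_subset_Icc hs01.1 ht01.2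
  have hai : Function.Injective a := by
    intro x y hxy
    have : x * (v - u) = y * (v - u) := by linarith [show a x = a y from hxy]
    exact mul_right_cancel₀ (by linarith : v - u ≠ 0) this
  have hbi : Function.Injective b := by
    intro x y hxy
    have : (x - 1) * (s - t) = (y - 1) * (s - t) := by linarith [show b x = b y from hxy]
    linarith [mul_right_cancel₀ (by linarith : s - t ≠ 0) this]
  let g : ℝ → X := fun x => if x ≤ 1 then σ (a x) else τ (b x)
  have hg : ContinuousOn g (Icc 0 2) := by
    have h01 : ContinuousOn g (Icc 0 1) := by
      refine (hσ.comp hac.continuousOn fun x hx => ha x hx.1 hx.2).congr fun x hx => ?_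
      exact if_pos hx.2
    have h12 : ContinuousOn g (Icc 1 2) := by
      refine (hτ.comp hbc.continuousOn fun x hx => hst01 (hb x hx.1 hx.2)).congr fun x hx => ?_
      rcases hx.1.eq_or_lt with rfl | h
      · have e1 : a 1 = v := by simp [a]
        have e2 : b 1 = t := by simp [b]
        have e3 : g 1 = σ (a 1) := if_pos le_rfl
        rw [e3, e1, Function.comp_apply, e2, hvt]
      · exact if_neg (not_le.2 h)
    rw [← Icc_union_Icc_eq_Icc zero_le_one one_le_two]
    exact h01.union_of_isClosed h12 isClosed_Icc isClosed_Icc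
  have hg2 : g 0 = g 2 := by
    have e1 : a 0 = u := by simp [a]
    have e2 : b 2 = s := by
      have : b 2 = t + (2 - 1) * (s - t) := rfl
      rw [this]; ring
    have e3 : g 0 = σ (a 0) := if_pos zero_le_one
    have e4 : g 2 = τ (b 2) := if_neg (by norm_num)
    rw [e3, e4, e1, e2, hus]
  have hinj : InjOn g (Ico 0 2) := by
    have hmix : ∀ x y : ℝ, 0 ≤ x → x ≤ 1 → 1 < y → y < 2 → σ (a x) ≠ τ (b y) :=
      fun x y hx0 hx1 hy1 hy2 he => hoff _ (hb' y hy1 hy2) ⟨a x, ha x hx0 hx1, he⟩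
    intro x hx y hy hxy
    simp only [g] at hxy
    split_ifs at hxy with hx1 hy1 hy1
    · exact hai (hσi (ha x hx.1 hx1) (ha y hy.1 hy1) hxy)
    · exact absurd hxy (hmix x y hx.1 hx1 (not_le.1 hy1) hy.2)
    · exact absurd hxy.symm (hmix y x hy.1 hy1 (not_le.1 hx1) hx.2)
    · exact hbi (hτi (hst01 (hb x (not_le.1 hx1).le hx.2.le))
        (hst01 (hb y (not_le.1 hy1).le hy.2.le)) hxy)
  refine ⟨g '' Ico 0 2, ?_, isSimpleClosedCurve_image two_pos hg hg2 hinj⟩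
  rintro _ ⟨x, hx, rfl⟩
  by_cases hx1 : x ≤ 1
  · left
    have : g x = σ (a x) := if_pos hx1
    rw [this]
    exact mem_image_of_mem _ (ha x hx.1 hx1)
  · right
    have : g x = τ (b x) := if_neg hx1
    rw [this]
    exact mem_image_of_mem _ (hst01 (hb x (not_le.1 hx1).le hx.2.le))

variable [CompactSpace X] [LocallyConnectedSpace X]

/-- Distinct points of a connected open set are joined by an arc in it. -/
lemma exists_arc {V : Set X} (hV : IsOpen V) (hVc : IsPreconnected V) {x y : X} (hx : x ∈ V)
    (hy : y ∈ V) (hxy : x ≠ y) : ∃ σ : ℝ → X, ContinuousOn σ (Icc 0 1) ∧ InjOn σ (Icc 0 1) ∧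
      σ 0 = x ∧ σ 1 = y ∧ ∀ t ∈ Icc (0 : ℝ) 1, σ t ∈ V := by
  have : LocallyPathConnectedSpace X := locallyPathConnectedSpace_of_compact
  have hj : JoinedIn V x y := (hV.isConnected_iff_isPathConnected.1 ⟨⟨x, hx⟩, hVc⟩).joinedIn
    x hx y hy
  obtain ⟨σ, hσ, hσi, h0, h1, him⟩ := exists_injOn_path hj.somePath.extend.continuous
    (by rwa [Path.extend_zero, Path.extend_one])
  refine ⟨σ, hσ, hσi, by rw [h0, Path.extend_zero], by rw [h1, Path.extend_one], fun t ht => ?_⟩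
  obtain ⟨s, hs, he⟩ := him t ht
  rw [he, Path.extend_apply _ hs]
  exact hj.somePath_mem _

/-- An arc in a connected open set contains a point that is not a local cut point; since this point
does not separate the end points of the arc, they are joined by a second arc that avoids it. -/
lemma exists_isSimpleClosedCurve [ConnectedSpace X] [Nontrivial X]
    (hcut : {x : X | IsLocalCutPoint x}.Countable) {U : Set X} (hU : IsOpen U)
    (hne : U.Nonempty) : ∃ C ⊆ U, IsSimpleClosedCurve C := by
  obtain ⟨x, hx⟩ := hne
  set V := connectedComponentIn U x with hVdef
  have hV : IsOpen V := hU.connectedComponentIn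
  have hxV : x ∈ V := mem_connectedComponentIn hx
  have hVc : IsPreconnected V := isPreconnected_connectedComponentIn
  obtain ⟨y, hyV, hyx⟩ := (infinite_of_mem_nhds x (hV.mem_nhds hxV)).nontrivial.exists_ne x
  obtain ⟨σ, hσ, hσi, hσ0, hσ1, hσV⟩ := exists_arc hV hVc hxV hyV hyx.symm
  obtain ⟨c, hc, hcr⟩ : ∃ c ∈ Ioo (0 : ℝ) 1, ¬ IsLocalCutPoint (σ c) := by
    by_contra hcon
    push Not at hcon
    refine Cardinal.Real.Ioo_countable_iff.not.2 (not_le.2 (zero_lt_one (α := ℝ))) ?_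
    exact MapsTo.countable_of_injOn (f := σ) (t := {x | IsLocalCutPoint x}) hcon
      (hσi.mono Ioo_subset_Icc_self) hcut
  have hc01 : c ∈ Icc (0 : ℝ) 1 := Ioo_subset_Icc_self hc
  have hcut : IsPreconnected (V \ {σ c}) := by
    by_contra hcon
    exact hcr ⟨V, hV, ⟨⟨x, hxV⟩, hVc⟩, hσV c hc01, hcon⟩
  have hne : ∀ t ∈ Icc (0 : ℝ) 1, t ≠ c → σ t ∉ ({σ c} : Set X) := fun t ht htc h =>
    htc (hσi ht hc01 h)
  obtain ⟨τ, hτ, hτi, hτ0, hτ1, hτV⟩ := exists_arc (hV.sdiff isClosed_singleton) hcut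
    ⟨hxV, hσ0 ▸ hne 0 ⟨le_rfl, zero_le_one⟩ hc.1.ne⟩
    ⟨hyV, hσ1 ▸ hne 1 ⟨zero_le_one, le_rfl⟩ hc.2.ne'⟩ hyx.symm
  obtain ⟨C, hC, hCs⟩ := exists_isSimpleClosedCurve_of_arcs hσ hσi hτ hτi (hσ0.trans hτ0.symm)
    (hσ1.trans hτ1.symm) hc fun t ht => (hτV t ht).2
  refine ⟨C, hC.trans ?_, hCs⟩
  rintro _ (⟨t, ht, rfl⟩ | ⟨t, ht, rfl⟩)
  · exact connectedComponentIn_subset _ _ (hσV t ht)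
  · exact connectedComponentIn_subset _ _ (hτV t ht).1

end SimpleClosedCurves

end CWExp

theorem mainTheorem3 {X : Type*} [MetricSpace X] [CompactSpace X] [ConnectedSpace X]
    [LocallyConnectedSpace X] [Nontrivial X] (f : X ≃ₜ X) (hf : CWExp.IsCWExpansive f) :
    (∀ x : X, CWExp.order x = 𝔠) ∧
    CWExp.NowhereRimCountable X ∧
    (CWExp.IsOneDimensional X →
      {E : Set X | CWExp.IsCyclicElement E}.Finite ∧
      ⋃₀ {E : Set X | CWExp.IsCyclicElement E} = univ ∧
      {x : X | CWExp.IsLocalCutPoint x}.Countable ∧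
      (∀ U : Set X, IsOpen U → U.Nonempty →
        ∃ C : Set X, C ⊆ U ∧ CWExp.IsSimpleClosedCurve C) ∧
      (∀ x : X, ∃ K : Set X, x ∈ K ∧ CWExp.IsContinuumOfConvergence K)) := by
  obtain ⟨α, hα⟩ := hf.exists_isCWConstant
  have hX := hα.nowhereRimCountable
  refine ⟨hα.order_eq_continuum, hX, fun _ => ⟨?_, CWExp.sUnion_isCyclicElement,
    CWExp.countable_isLocalCutPoint hX,
    fun U hU hne => CWExp.exists_isSimpleClosedCurve (CWExp.countable_isLocalCutPoint hX) hU hne,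
    hα.exists_isContinuumOfConvergence⟩⟩
  refine CWExp.finite_isCyclicElement hX (fun p hp => ?_) hα.finite_isTrueCyclicElement
  -- An end point would have order one, but all points have order `𝔠`.
  have h1 : 𝔠 = 1 := (hα.order_eq_continuum p).symm.trans hp
  exact (Cardinal.one_lt_aleph0.trans Cardinal.aleph0_lt_continuum).ne' h1
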